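/- An index is a finite sequence of positive integers. For an index $\mathbf k=(k_1,\dots,k_d)$ and $n\ge 1$ put $\zeta_n^\star(\mathbf k)=\sum_{n\ge n_1\ge\cdots\ge n_d\ge1} n_1^{-k_1}\cdots n_d^{-k_d}$, with $\zeta^\star_n(\emptyset)=1$, and define the multiple zeta $B$-star value $$\zeta_B^\star(k_1,\dots,k_d)=\sum_{n=1}^\infty \frac{\zeta_n^\star(k_2,\dots,k_d)}{n^{k_1}4^n}\binom{2n}{n}.$$ The Hoffman dual of an index $\mathbf m=(m_1,\dots,m_p)$ is the index $\mathbf m^\vee=(m_1',\dots,m'_{p'})$ determined by $m_1+\cdots+m_p=m_1'+\cdots+m'_{p'}=:w$ and $$\{1,\dots,w-1\}=\{m_1,m_1+m_2,\dots,m_1+\cdots+m_{p-1}\}\sqcup\{m'_1,m'_1+m'_2,\dots,m'_1+\cdots+m'_{p'-1}\}$$ (and $\emptyset^\vee=\emptyset$). For nonzero integers $k_1,\dots,k_d$ with $k_1\neq 1$, the alternating multiple zeta value of depth $d$ is $$\zeta(k_1,\dots,k_d)=\lim_{N\to\infty}\ \sum_{N\ge n_1>\cdots>n_d\ge1}\ \prod_{j=1}^d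 \frac{\operatorname{sgn}(k_j)^{n_j}}{n_j^{|k_j|}}.$$ Let $\mathbf m=(m_1,\dots,m_p)$ be an index, let $r$ be a positive integer, and put $\mathbf m_p=(m_1,m_2+1,\dots,m_p+1)$. Then the series defining $\zeta_B^\star(r,\mathbf m_p^\vee)$ converges, and $\zeta_B^\star(r,\mathbf m_p^\vee)$ lies in the $\mathbb Q$-subalgebra of $\mathbb R$ generated by the alternating multiple zeta values of depth at most $p+r$. -/

import Mathlib

open Filter Topology

/-- `m` is an index: a finite sequence of positive integers. -/
def IsIndex (m : List ℕ) : Prop := ∀ i ∈ m, 0 < i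

/-- The multiple harmonic star sum
`ζ⋆_N(k₁,…,k_d) = ∑_{N ≥ n₁ ≥ ⋯ ≥ n_d ≥ 1} n₁^{-k₁} ⋯ n_d^{-k_d}`, equal to `1` for `d = 0`. -/
noncomputable def starSum : List ℕ → ℕ → ℝ
  | [], _ => 1
  | k :: ks, N => ∑ n ∈ Finset.Icc 1 N, 1 / (n : ℝ) ^ k * starSum ks n

/-- The term with index `n` of the series that defines `ζ⋆_B(k, k₂, …, k_d)`, where
`ks = (k₂, …, k_d)`. -/
noncomputable def zetaBStarTerm (k : ℕ) (ks : List ℕ) (n : ℕ) : ℝ :=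
  starSum ks n / ((n : ℝ) ^ k * 4 ^ n) * (Nat.choose (2 * n) n : ℝ)

/-- The multiple zeta `B`-star value
`ζ⋆_B(k, k₂, …, k_d) = ∑_{n ≥ 1} ζ⋆_n(k₂, …, k_d) / (n ^ k * 4 ^ n) * binom (2n) n`. -/
noncomputable def zetaBStar (k : ℕ) (ks : List ℕ) : ℝ :=
  ∑' n : ℕ, zetaBStarTerm k ks (n + 1)

/-- The truncated alternating multiple zeta sum
`∑_{N ≥ n₁ > ⋯ > n_d ≥ 1} ∏ⱼ sgn(kⱼ) ^ nⱼ / nⱼ ^ |kⱼ|`. -/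
noncomputable def altSum : List ℤ → ℕ → ℝ
  | [], _ => 1
  | k :: ks, N => ∑ n ∈ Finset.Icc 1 N,
      (k.sign : ℝ) ^ n / (n : ℝ) ^ k.natAbs * altSum ks (n - 1)

/-- `(k₁, …, k_d)` is a sequence of nonzero integers with `k₁ ≠ 1`, so that the alternating
multiple zeta series converges (`k₁ = -1` is allowed). -/
def IsAltAdmissible (k : List ℤ) : Prop := (∀ i ∈ k, i ≠ 0) ∧ k.head? ≠ some 1

/-- The set of alternating multiple zeta values `ζ(k₁, …, k_e)` of depth `e ≤ d`; the value is the
limit of the truncated sums as the bound on the largest summation variable `n₁` tends to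
infinity. -/
def altMZVs (d : ℕ) : Set ℝ :=
  {x | ∃ k : List ℤ, IsAltAdmissible k ∧ k.length ≤ d ∧ Tendsto (altSum k) atTop (𝓝 x)}

/-- The index `(m₁, m₂ + 1, …, m_p + 1)`. -/
def shiftTail : List ℕ → List ℕ
  | [] => []
  | a :: l => a :: l.map (· + 1)

/-- The set `{m₁, m₁ + m₂, …, m₁ + ⋯ + m_{p-1}}`. -/
def innerSums (m : List ℕ) : Set ℕ :=
  {x | ∃ j, 0 < j ∧ j < m.length ∧ (m.take j).sum = x}

/-- The defining property of the Hoffman dual `m'` of an index `m`. -/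
def IsHoffmanDual (m m' : List ℕ) : Prop :=
  IsIndex m' ∧ m'.sum = m.sum ∧ Disjoint (innerSums m) (innerSums m') ∧
    innerSums m ∪ innerSums m' = {x | 1 ≤ x ∧ x < m.sum}

/-- The Hoffman dual of an index, computed recursively. `isHoffmanDual_iff` below shows that it
is the one index with the defining property. -/
def hoffmanDual : List ℕ → List ℕ
  | [] => []
  | [a] => List.replicate a 1
  | a :: b :: l => List.replicate (a - 1) 1 ++ (hoffmanDual (b :: l)).modifyHead (· + 1)

theorem innerSums_nil : innerSums [] = ∅ := by
  ext x; simp [innerSums]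

theorem innerSums_singleton (a : ℕ) : innerSums [a] = ∅ := by
  ext x
  simp only [innerSums, List.length_singleton, Set.mem_setOf_eq, Set.mem_empty_iff_false,
    iff_false]
  rintro ⟨j, h0, h1, -⟩
  omega

theorem mem_innerSums_cons (a : ℕ) {l : List ℕ} (hl : l ≠ []) (x : ℕ) :
    x ∈ innerSums (a :: l) ↔ x = a ∨ ∃ y ∈ innerSums l, x = a + y := by
  have hpos : 0 < l.length := List.length_pos_iff.2 hl
  constructor
  · rintro ⟨j, h0, h1, rfl⟩
    obtain ⟨i, rfl⟩ : ∃ i, j = i + 1 := ⟨j - 1, by omega⟩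
    rcases Nat.eq_zero_or_pos i with rfl | hi
    · left; simp
    · right
      exact ⟨_, ⟨i, hi, by simpa using h1, rfl⟩, by simp⟩
  · rintro (rfl | ⟨y, ⟨j, h0, h1, rfl⟩, rfl⟩)
    · exact ⟨1, one_pos, by simpa using hpos, by simp⟩
    · exact ⟨j + 1, by omega, by simpa using h1, by simp⟩

theorem mem_innerSums_modifyHead (l : List ℕ) (x : ℕ) :
    x ∈ innerSums (l.modifyHead (· + 1)) ↔ ∃ y ∈ innerSums l, x = y + 1 := by
  rcases l with _ | ⟨a, _ | ⟨b, l⟩⟩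
  · simp [innerSums_nil]
  · simp [innerSums_singleton]
  · simp only [List.modifyHead_cons]
    rw [mem_innerSums_cons _ (by simp)]
    constructor
    · rintro (rfl | ⟨y, hy, rfl⟩)
      · exact ⟨a, (mem_innerSums_cons _ (by simp) _).2 (Or.inl rfl), rfl⟩
      · exact ⟨a + y, (mem_innerSums_cons _ (by simp) _).2 (Or.inr ⟨y, hy, rfl⟩), by omega⟩
    · rintro ⟨y, hy, rfl⟩
      rcases (mem_innerSums_cons _ (by simp) _).1 hy with rfl | ⟨z, hz, rfl⟩
      · left; rfl
      · right; exact ⟨z, hz, by omega⟩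

theorem mem_innerSums_replicate_append (k : ℕ) {l : List ℕ} (hl : l ≠ []) (x : ℕ) :
    x ∈ innerSums (List.replicate k 1 ++ l) ↔
      (1 ≤ x ∧ x ≤ k) ∨ ∃ y ∈ innerSums l, x = k + y := by
  induction k generalizing x with
  | zero =>
    simp only [List.replicate_zero, List.nil_append, zero_add, exists_eq_right']
    constructor
    · exact Or.inr
    · rintro (h | h)
      · omega
      · exact h
  | succ k ih =>
    rw [List.replicate_succ, List.cons_append, mem_innerSums_cons _ (by simp [hl])]
    simp only [ih]
    constructor
    · rintro (rfl | ⟨y, (h | ⟨z, hz, rfl⟩), rfl⟩)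
      · left; omega
      · left; omega
      · right; exact ⟨z, hz, by omega⟩
    · rintro (h | ⟨z, hz, rfl⟩)
      · by_cases hx : x = 1
        · exact Or.inl hx
        · exact Or.inr ⟨x - 1, Or.inl (by omega), by omega⟩
      · exact Or.inr ⟨k + z, Or.inr ⟨z, hz, rfl⟩, by omega⟩

theorem pos_of_mem_innerSums {m : List ℕ} (hm : IsIndex m) {x : ℕ} (hx : x ∈ innerSums m) :
    0 < x ∧ x < m.sum := by
  induction m generalizing x with
  | nil => simp [innerSums_nil] at hx
  | cons a l ih =>
    have ha : 0 < a := hm a (by simp)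
    have hl : IsIndex l := fun i hi => hm i (by simp [hi])
    rcases l with _ | ⟨b, l⟩
    · simp [innerSums_singleton] at hx
    · have hb : 0 < b := hl b (by simp)
      rw [mem_innerSums_cons _ (by simp)] at hx
      rw [List.sum_cons]
      rcases hx with rfl | ⟨y, hy, rfl⟩
      · simp only [List.sum_cons]; omega
      · have := ih hl hy; omega

theorem hoffmanDual_ne_nil {a : ℕ} {l : List ℕ} (h : IsIndex (a :: l)) :
    hoffmanDual (a :: l) ≠ [] := by
  induction l generalizing a with
  | nil =>
    have : 0 < a := h a (by simp)
    simp only [hoffmanDual, ne_eq, List.replicate_eq_nil_iff]; omega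
  | cons b l ih =>
    have := ih (a := b) (fun i hi => h i (by simp [hi]))
    rcases hd : hoffmanDual (b :: l) with _ | ⟨c, d⟩
    · exact absurd hd this
    · simp [hoffmanDual, hd]

theorem hoffmanDual_spec {m : List ℕ} (hm : IsIndex m) : IsHoffmanDual m (hoffmanDual m) := by
  induction m with
  | nil =>
    refine ⟨by simp [hoffmanDual, IsIndex], by simp [hoffmanDual], by simp [innerSums_nil], ?_⟩
    ext x; simp [innerSums_nil, hoffmanDual]
  | cons a l ih =>
    have ha : 0 < a := hm a (by simp)
    have hl : IsIndex l := fun i hi => hm i (by simp [hi])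
    rcases l with _ | ⟨b, l⟩
    · obtain ⟨c, rfl⟩ : ∃ c, a = c + 1 := ⟨a - 1, by omega⟩
      have key : ∀ x, x ∈ innerSums (hoffmanDual [c + 1]) ↔ 1 ≤ x ∧ x ≤ c := by
        intro x
        have : hoffmanDual [c + 1] = List.replicate c 1 ++ [1] := by
          simp [hoffmanDual, List.replicate_succ']
        rw [this, mem_innerSums_replicate_append _ (by simp)]
        simp [innerSums_singleton]
      refine ⟨?_, by simp [hoffmanDual], by simp [innerSums_singleton], ?_⟩
      · intro i hi
        simp only [hoffmanDual, List.mem_replicate] at hi; omega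
      · ext x
        simp only [innerSums_singleton, Set.empty_union, key, List.sum_singleton,
          Set.mem_setOf_eq]
        omega
    · obtain ⟨h1, h2, h3, h4⟩ := ih hl
      have hb : 0 < b := hl b (by simp)
      have hne := hoffmanDual_ne_nil hl
      have key : ∀ x, x ∈ innerSums (hoffmanDual (a :: b :: l)) ↔
          (1 ≤ x ∧ x < a) ∨ ∃ y ∈ innerSums (hoffmanDual (b :: l)), x = a + y := by
        intro x
        have hne' : (hoffmanDual (b :: l)).modifyHead (· + 1) ≠ [] := by simpa using hne
        rw [hoffmanDual, mem_innerSums_replicate_append _ hne']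
        simp only [mem_innerSums_modifyHead]
        constructor
        · rintro (h | ⟨y, ⟨z, hz, rfl⟩, rfl⟩)
          · left; omega
          · right; exact ⟨z, hz, by omega⟩
        · rintro (h | ⟨z, hz, rfl⟩)
          · left; omega
          · right; exact ⟨z + 1, ⟨z, hz, rfl⟩, by omega⟩
      have h4' : ∀ x, (x ∈ innerSums (b :: l) ∨ x ∈ innerSums (hoffmanDual (b :: l))) ↔
          1 ≤ x ∧ x < (b :: l).sum := fun x => by
        have := Set.ext_iff.1 h4 x
        simpa using this
      have h3' : ∀ x, x ∈ innerSums (b :: l) → x ∉ innerSums (hoffmanDual (b :: l)) :=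
        fun x hx hx' => Set.disjoint_left.1 h3 hx hx'
      have hsb : 0 < (b :: l).sum := by simp only [List.sum_cons]; omega
      refine ⟨?_, ?_, ?_, ?_⟩
      · intro i hi
        rw [hoffmanDual, List.mem_append] at hi
        rcases hi with hi | hi
        · simp only [List.mem_replicate] at hi; omega
        · rcases hd : hoffmanDual (b :: l) with _ | ⟨c, d⟩
          · exact absurd hd hne
          · simp only [hd, List.modifyHead_cons, List.mem_cons] at hi
            rcases hi with rfl | hi
            · omega
            · exact h1 i (by simp [hd, hi])
      · rcases hd : hoffmanDual (b :: l) with _ | ⟨c, d⟩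
        · exact absurd hd hne
        · rw [hd] at h2
          rw [hoffmanDual, hd, List.sum_cons (a := a), ← h2]
          simp only [List.modifyHead_cons, List.sum_append, List.sum_replicate, smul_eq_mul,
            List.sum_cons]
          omega
      · rw [Set.disjoint_left]
        intro x hx hx'
        rw [mem_innerSums_cons _ (by simp)] at hx
        rw [key] at hx'
        rcases hx with rfl | ⟨y, hy, rfl⟩
        · rcases hx' with h | ⟨z, hz, h⟩
          · omega
          · have := (h4' z).1 (Or.inr hz); omega
        · rcases hx' with h | ⟨z, hz, h⟩
          · omega
          · obtain rfl : y = z := by omega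
            exact h3' y hy hz
      · ext x
        rw [Set.mem_union, mem_innerSums_cons _ (by simp), key, List.sum_cons,
          Set.mem_setOf_eq]
        constructor
        · rintro ((rfl | ⟨y, hy, rfl⟩) | (h | ⟨y, hy, rfl⟩))
          · omega
          · have := (h4' y).1 (Or.inl hy); omega
          · omega
          · have := (h4' y).1 (Or.inr hy); omega
        · intro h
          rcases lt_trichotomy x a with hx | rfl | hx
          · right; left; omega
          · left; left; rfl
          · rcases (h4' (x - a)).2 (by omega) with hy | hy
            · left; right; exact ⟨_, hy, by omega⟩
            · right; right; exact ⟨_, hy, by omega⟩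

theorem eq_of_innerSums_eq {m m' : List ℕ} (hm : IsIndex m) (hm' : IsIndex m')
    (hs : m.sum = m'.sum) (h : innerSums m = innerSums m') : m = m' := by
  induction m generalizing m' with
  | nil =>
    rcases m' with _ | ⟨b, l'⟩
    · rfl
    · have := hm' b (by simp)
      simp only [List.sum_nil, List.sum_cons] at hs; omega
  | cons a l ih =>
    have hl : IsIndex l := fun i hi => hm i (by simp [hi])
    have ha := hm a (by simp)
    rcases m' with _ | ⟨b, l'⟩
    · simp only [List.sum_nil, List.sum_cons] at hs; omega
    · have hl' : IsIndex l' := fun i hi => hm' i (by simp [hi])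
      have hx := fun x => Set.ext_iff.1 h x
      rcases eq_or_ne l [] with rfl | hn <;> rcases eq_or_ne l' [] with rfl | hn'
      · simpa using hs
      · have := (hx b).2 ((mem_innerSums_cons _ hn' _).2 (Or.inl rfl))
        simp [innerSums_singleton] at this
      · have := (hx a).1 ((mem_innerSums_cons _ hn _).2 (Or.inl rfl))
        simp [innerSums_singleton] at this
      · simp only [mem_innerSums_cons _ hn, mem_innerSums_cons _ hn'] at hx
        have hab : a = b := by
          rcases (hx a).1 (Or.inl rfl) with h1 | ⟨y, -, h1⟩
          · exact h1
          · rcases (hx b).2 (Or.inl rfl) with h2 | ⟨z, -, h2⟩ <;> omega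
        subst hab
        have : l = l' := by
          refine ih hl hl' (by simpa using hs) ?_
          ext y
          have := hx (a + y)
          constructor
          · intro hy
            rcases this.1 (Or.inr ⟨y, hy, rfl⟩) with h1 | ⟨z, hz, h1⟩
            · have := pos_of_mem_innerSums hl hy; omega
            · obtain rfl : y = z := by omega
              exact hz
          · intro hy
            rcases this.2 (Or.inr ⟨y, hy, rfl⟩) with h1 | ⟨z, hz, h1⟩
            · have := pos_of_mem_innerSums hl' hy; omega
            · obtain rfl : y = z := by omega
              exact hz
        rw [this]

theorem isHoffmanDual_iff {m : List ℕ} (hm : IsIndex m) (m' : List ℕ) :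
    IsHoffmanDual m m' ↔ m' = hoffmanDual m := by
  constructor
  · rintro ⟨h1, h2, h3, h4⟩
    obtain ⟨g1, g2, g3, g4⟩ := hoffmanDual_spec hm
    refine eq_of_innerSums_eq h1 g1 (h2.trans g2.symm) ?_
    ext x
    have e := (Set.ext_iff.1 h4 x).trans (Set.ext_iff.1 g4 x).symm
    simp only [Set.mem_union] at e
    constructor
    · intro hx
      exact (e.1 (Or.inr hx)).resolve_left fun hx' => Set.disjoint_left.1 h3 hx' hx
    · intro hx
      exact (e.2 (Or.inr hx)).resolve_left fun hx' => Set.disjoint_left.1 g3 hx' hx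
  · rintro rfl
    exact hoffmanDual_spec hm

/-! Star sums are interpolated by expectations. A word in two letters yields a variable Y in (0, 1),
built from independent uniform variables by x t and 1 - (1 - x)(1 - t). Averaging over the outermost
t turns Y^s into x^s / (s + 1) or (1 - x^(s+1)) / ((1 - x)(s + 1)). Hence S_k(s) = E[(1 - Y^s) / (1
- Y)], taken for the word of k = (k₁, k'), vanishes at 0 and satisfies S_k(s + 1) = S_k(s) +
S_{k'}(s + 1) / (s + 1)^{k₁} for s > -1. So it extends n ↦ ζ⋆_n(k) to real arguments.

The reflection y ↦ 1 - y exchanges the two letters, which on indices is Hoffman duality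
(`indexWord_hoffmanDual`). Expanding (1 - x)^(-1/2) in central binomial coefficients then gives
ζ⋆_B(r, q^∨) = -S_κ(-1/2), where κ = (1, …, 1, q₁ + 1, q₂, …) with r - 1 leading ones for nonempty q
(`hasSum_zetaBStarTerm`). The depth of κ is controlled by the depth of q, not by that of its dual.

It remains to evaluate S_κ(-1/2). The sums of (-1)^n (S(n/2) - S(n/2 - 1)) telescope and tend to
S(-1/2). By induction on depth, S(n/2) = u_n + (-1)^n v_n with u, v combinations of truncated
alternating sums (`starInterp_half_spec`). Single truncated sums may diverge, but each is a
polynomial in the harmonic number H_N, with coefficients in the algebra of alternating values, up to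
O(N^(-δ)) (`isHarmPoly_replicate_append`). A convergent combination forces a constant polynomial, so
its limit lies in the algebra (`IsHarmPoly.limit_mem`). -/

/-! ### Laws of words -/

section WordLaw
open MeasureTheory Set

/-- The uniform distribution on `(0, 1)`. -/
noncomputable def unifLaw : Measure ℝ := volume.restrict (Ioo 0 1)

/-- The two operations `(x, t) ↦ x t` and `(x, t) ↦ 1 - (1 - x) (1 - t)` on the unit interval. -/
def unitOp : Bool → ℝ × ℝ → ℝ
  | true, p => p.1 * p.2
  | false, p => p.1 + p.2 - p.1 * p.2

/-- The law of the random variable obtained from a uniform variable by applying the operations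
`unitOp` of a word to independent uniform variables. -/
noncomputable def wordLaw : List Bool → Measure ℝ
  | [] => unifLaw
  | b :: w => ((wordLaw w).prod unifLaw).map (unitOp b)

instance isProbabilityMeasure_unifLaw : IsProbabilityMeasure unifLaw :=
  ⟨by simp [unifLaw]⟩

theorem measurable_unitOp (b : Bool) : Measurable (unitOp b) := by
  cases b <;> unfold unitOp <;> fun_prop

instance isProbabilityMeasure_wordLaw (w : List Bool) : IsProbabilityMeasure (wordLaw w) := by
  induction w with
  | nil => exact isProbabilityMeasure_unifLaw
  | cons b w ih => exact Measure.isProbabilityMeasure_map (measurable_unitOp b).aemeasurable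

theorem unitOp_mem_Ioo (b : Bool) {x t : ℝ} (hx : x ∈ Ioo (0 : ℝ) 1) (ht : t ∈ Ioo (0 : ℝ) 1) :
    unitOp b (x, t) ∈ Ioo (0 : ℝ) 1 := by
  obtain ⟨hx0, hx1⟩ := hx
  obtain ⟨ht0, ht1⟩ := ht
  cases b <;> simp only [unitOp, mem_Ioo] <;> constructor <;>
    nlinarith [mul_pos hx0 ht0, mul_pos (sub_pos.2 hx1) (sub_pos.2 ht1),
      mul_pos hx0 (sub_pos.2 ht1)]

theorem ae_unifLaw_mem_Ioo : ∀ᵐ x ∂unifLaw, x ∈ Ioo (0 : ℝ) 1 :=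
  ae_restrict_mem measurableSet_Ioo

theorem ae_wordLaw_mem_Ioo (w : List Bool) : ∀ᵐ x ∂wordLaw w, x ∈ Ioo (0 : ℝ) 1 := by
  induction w with
  | nil => exact ae_unifLaw_mem_Ioo
  | cons b w ih =>
    rw [wordLaw, ae_map_iff (p := (· ∈ Ioo (0 : ℝ) 1))
      (measurable_unitOp b).aemeasurable measurableSet_Ioo]
    have h1 : ∀ᵐ p ∂(wordLaw w).prod unifLaw, p.1 ∈ Ioo (0 : ℝ) 1 :=
      Measure.quasiMeasurePreserving_fst.ae ih
    have h2 : ∀ᵐ p ∂(wordLaw w).prod unifLaw, p.2 ∈ Ioo (0 : ℝ) 1 :=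
      Measure.quasiMeasurePreserving_snd.ae ae_unifLaw_mem_Ioo
    filter_upwards [h1, h2] with p hp1 hp2
    exact unitOp_mem_Ioo b hp1 hp2

/-- Integrating out the outermost uniform variable of a word. -/
theorem integral_wordLaw_cons (b : Bool) (w : List Bool) {g h : ℝ → ℝ} (hg : Measurable g)
    (hg0 : ∀ y ∈ Ioo (0 : ℝ) 1, 0 ≤ g y) (hh : Integrable h (wordLaw w))
    (hint : ∀ x ∈ Ioo (0 : ℝ) 1, Integrable (fun t => g (unitOp b (x, t))) unifLaw)
    (heq : ∀ x ∈ Ioo (0 : ℝ) 1, ∫ t, g (unitOp b (x, t)) ∂unifLaw = h x) :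
    Integrable g (wordLaw (b :: w)) ∧ ∫ y, g y ∂wordLaw (b :: w) = ∫ x, h x ∂wordLaw w := by
  have hm : Measurable fun p => g (unitOp b p) := hg.comp (measurable_unitOp b)
  have hI : Integrable (fun p => g (unitOp b p)) ((wordLaw w).prod unifLaw) := by
    rw [integrable_prod_iff hm.aestronglyMeasurable]
    -- As g is nonnegative on the unit interval, the inner integral of its norm is h itself, so
    -- integrability of h suffices.
    refine ⟨(ae_wordLaw_mem_Ioo w).mono fun x hx => hint x hx, hh.congr ?_⟩
    filter_upwards [ae_wordLaw_mem_Ioo w] with x hx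
    rw [← heq x hx]
    refine integral_congr_ae ?_
    filter_upwards [ae_unifLaw_mem_Ioo] with t ht
    exact (Real.norm_of_nonneg (hg0 _ (unitOp_mem_Ioo b hx ht))).symm
  refine ⟨(integrable_map_measure hg.aestronglyMeasurable
    (measurable_unitOp b).aemeasurable).2 hI, ?_⟩
  rw [wordLaw, integral_map (measurable_unitOp b).aemeasurable hg.aestronglyMeasurable,
    integral_prod _ hI]
  exact integral_congr_ae ((ae_wordLaw_mem_Ioo w).mono fun x hx => heq x hx)

theorem integral_unifLaw (g : ℝ → ℝ) : ∫ t, g t ∂unifLaw = ∫ t in (0 : ℝ)..1, g t := by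
  rw [unifLaw, intervalIntegral.integral_of_le zero_le_one, integral_Ioc_eq_integral_Ioo]

theorem integrable_unifLaw_iff (g : ℝ → ℝ) :
    Integrable g unifLaw ↔ IntervalIntegrable g volume 0 1 := by
  rw [unifLaw, intervalIntegrable_iff_integrableOn_Ioo_of_le zero_le_one]
  rfl

theorem integrable_rpow_unifLaw {s : ℝ} (hs : -1 < s) :
    Integrable (fun t : ℝ => t ^ s) unifLaw :=
  (integrable_unifLaw_iff _).2 (intervalIntegral.intervalIntegrable_rpow' hs)

theorem integral_rpow_unifLaw {s : ℝ} (hs : -1 < s) : ∫ t, t ^ s ∂unifLaw = 1 / (s + 1) := by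
  rw [integral_unifLaw, integral_rpow (Or.inl hs), Real.one_rpow,
    Real.zero_rpow (by linarith), sub_zero]

/-- The integrand `(1 - y ^ s) / (1 - y)`, an interpolation of the geometric sum
`1 + y + ⋯ + y ^ (s - 1)`. -/
noncomputable def geomKernel (s y : ℝ) : ℝ := (1 - y ^ s) / (1 - y)

theorem measurable_geomKernel (s : ℝ) : Measurable (geomKernel s) := by
  unfold geomKernel; fun_prop

theorem geomKernel_nonneg {s y : ℝ} (hs : 0 ≤ s) (hy : y ∈ Ioo (0 : ℝ) 1) :
    0 ≤ geomKernel s y :=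
  div_nonneg (sub_nonneg.2 (Real.rpow_le_one hy.1.le hy.2.le hs)) (sub_nonneg.2 hy.2.le)

theorem geomKernel_le_of_one_le {s y : ℝ} (hs : 1 ≤ s) (hy : y ∈ Ioo (0 : ℝ) 1) :
    geomKernel s y ≤ s := by
  have h := one_add_mul_self_le_rpow_one_add (s := y - 1) (by linarith [hy.1]) hs
  rw [add_sub_cancel] at h
  rw [geomKernel, div_le_iff₀ (sub_pos.2 hy.2)]
  linarith

theorem geomKernel_mono {s s' y : ℝ} (hs : s ≤ s') (hy : y ∈ Ioo (0 : ℝ) 1) :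
    geomKernel s y ≤ geomKernel s' y := by
  have h := Real.rpow_le_rpow_of_exponent_ge hy.1 hy.2.le hs
  have := sub_pos.2 hy.2
  unfold geomKernel
  gcongr

theorem geomKernel_add_one {s y : ℝ} (hy : y ∈ Ioo (0 : ℝ) 1) :
    geomKernel (s + 1) y = geomKernel s y + y ^ s := by
  have := (sub_pos.2 hy.2).ne'
  rw [geomKernel, geomKernel, Real.rpow_add_one hy.1.ne']
  field_simp
  ring

/-- Monotonicity in the exponent and Bernoulli's inequality at exponent s + 1 bound the kernel by a
constant. -/
theorem integrable_geomKernel_of_nonneg (w : List Bool) {s : ℝ} (hs : 0 ≤ s) :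
    Integrable (geomKernel s) (wordLaw w) := by
  refine (integrable_const (s + 1)).mono' (measurable_geomKernel s).aestronglyMeasurable ?_
  filter_upwards [ae_wordLaw_mem_Ioo w] with y hy
  rw [Real.norm_of_nonneg (geomKernel_nonneg hs hy)]
  exact (geomKernel_mono (by linarith) hy).trans (geomKernel_le_of_one_le (by linarith) hy)

theorem unitOp_true_rpow {x s : ℝ} (hs : -1 < s) (hx : x ∈ Ioo (0 : ℝ) 1) :
    Integrable (fun t => unitOp true (x, t) ^ s) unifLaw ∧
      ∫ t, unitOp true (x, t) ^ s ∂unifLaw = x ^ s / (s + 1) := by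
  have h : (fun t => unitOp true (x, t) ^ s) =ᵐ[unifLaw] fun t => x ^ s * t ^ s := by
    filter_upwards [ae_unifLaw_mem_Ioo] with t ht
    exact Real.mul_rpow hx.1.le ht.1.le
  refine ⟨(integrable_congr h).2 ((integrable_rpow_unifLaw hs).const_mul _), ?_⟩
  rw [integral_congr_ae h, integral_const_mul, integral_rpow_unifLaw hs, mul_one_div]

/-- The map t ↦ x + (1 - x) t sends (0, 1) affinely onto (x, 1), so this is the mean of y^s over (x,
1). -/
theorem unitOp_false_rpow {x s : ℝ} (hs : -1 < s) (hx : x ∈ Ioo (0 : ℝ) 1) :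
    Integrable (fun t => unitOp false (x, t) ^ s) unifLaw ∧
      ∫ t, unitOp false (x, t) ^ s ∂unifLaw = geomKernel (s + 1) x / (s + 1) := by
  have h1 := sub_pos.2 hx.2
  have e : (fun t => unitOp false (x, t) ^ s) = fun t => ((1 - x) * t + x) ^ s := by
    funext t; simp only [unitOp]; congr 1; ring
  rw [e]
  constructor
  · rw [integrable_unifLaw_iff]
    refine ContinuousOn.intervalIntegrable fun t ht => ?_
    rw [uIcc_of_le zero_le_one] at ht
    have : (1 - x) * t + x ≠ 0 := by nlinarith [mul_nonneg h1.le ht.1, hx.1]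
    have hc : ContinuousAt (fun t : ℝ => (1 - x) * t + x) t := by fun_prop
    exact (hc.rpow_const (Or.inl this)).continuousWithinAt
  · rw [integral_unifLaw, intervalIntegral.integral_comp_mul_add (fun y => y ^ s) h1.ne' x,
      integral_rpow (Or.inl hs)]
    have := h1.ne'
    have : s + 1 ≠ 0 := by linarith
    simp only [mul_one, mul_zero, zero_add, sub_add_cancel, Real.one_rpow, smul_eq_mul, geomKernel]
    field_simp

/-! ### Moments and geometric sums of a word -/

/-- The moment `E[Y ^ s]` of the law of a word. -/
noncomputable def wordMoment (w : List Bool) (s : ℝ) : ℝ := ∫ y, y ^ s ∂wordLaw w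

/-- The expectation of `(1 - Y ^ s) / (1 - Y)` for the law of a word. -/
noncomputable def wordSum (w : List Bool) (s : ℝ) : ℝ := ∫ y, geomKernel s y ∂wordLaw w

/-- For negative s the power is unbounded near 0. A letter `true` reproduces the same power, while
`false` replaces it by the kernel of exponent s + 1 > 0, which is bounded. -/
theorem integrable_rpow_wordLaw (w : List Bool) {s : ℝ} (hs : -1 < s) :
    Integrable (fun y : ℝ => y ^ s) (wordLaw w) := by
  induction w with
  | nil => exact integrable_rpow_unifLaw hs
  | cons b w ih =>
    cases b
    · exact (integral_wordLaw_cons false w (by fun_prop) (fun y hy => Real.rpow_nonneg hy.1.le s)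
        ((integrable_geomKernel_of_nonneg w (s := s + 1) (by linarith)).div_const _)
        (fun x hx => (unitOp_false_rpow hs hx).1) fun x hx => (unitOp_false_rpow hs hx).2).1
    · exact (integral_wordLaw_cons true w (by fun_prop) (fun y hy => Real.rpow_nonneg hy.1.le s)
        (ih.div_const _) (fun x hx => (unitOp_true_rpow hs hx).1)
        fun x hx => (unitOp_true_rpow hs hx).2).1

theorem wordMoment_nil {s : ℝ} (hs : -1 < s) : wordMoment [] s = 1 / (s + 1) :=
  integral_rpow_unifLaw hs

theorem wordMoment_false (w : List Bool) {s : ℝ} (hs : -1 < s) :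
    wordMoment (false :: w) s = wordSum w (s + 1) / (s + 1) := by
  rw [wordMoment, (integral_wordLaw_cons false w (by fun_prop)
    (fun y hy => Real.rpow_nonneg hy.1.le s)
    ((integrable_geomKernel_of_nonneg w (s := s + 1) (by linarith)).div_const _)
    (fun x hx => (unitOp_false_rpow hs hx).1) fun x hx => (unitOp_false_rpow hs hx).2).2,
    integral_div]
  rfl

theorem wordMoment_true (w : List Bool) {s : ℝ} (hs : -1 < s) :
    wordMoment (true :: w) s = wordMoment w s / (s + 1) := by
  rw [wordMoment, (integral_wordLaw_cons true w (by fun_prop)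
    (fun y hy => Real.rpow_nonneg hy.1.le s) ((integrable_rpow_wordLaw w hs).div_const _)
    (fun x hx => (unitOp_true_rpow hs hx).1) fun x hx => (unitOp_true_rpow hs hx).2).2,
    integral_div]
  rfl

theorem integrable_geomKernel (w : List Bool) {s : ℝ} (hs : -1 < s) :
    Integrable (geomKernel s) (wordLaw w) := by
  refine ((integrable_geomKernel_of_nonneg w (s := s + 1) (by linarith)).sub
    (integrable_rpow_wordLaw w hs)).congr ?_
  filter_upwards [ae_wordLaw_mem_Ioo w] with y hy
  simp [geomKernel_add_one hy]

theorem wordSum_zero (w : List Bool) : wordSum w 0 = 0 := by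
  simp [wordSum, geomKernel]

theorem wordSum_add_one (w : List Bool) {s : ℝ} (hs : -1 < s) :
    wordSum w (s + 1) = wordSum w s + wordMoment w s := by
  rw [wordSum, wordSum, wordMoment,
    ← integral_add (integrable_geomKernel w hs) (integrable_rpow_wordLaw w hs)]
  exact integral_congr_ae ((ae_wordLaw_mem_Ioo w).mono fun y hy => geomKernel_add_one hy)

theorem wordSum_mono (w : List Bool) {s s' : ℝ} (hs : -1 < s) (h : s ≤ s') :
    wordSum w s ≤ wordSum w s' :=
  integral_mono_ae (integrable_geomKernel w hs) (integrable_geomKernel w (hs.trans_le h))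
    ((ae_wordLaw_mem_Ioo w).mono fun _ hy => geomKernel_mono h hy)

/-! ### Duality -/

theorem map_one_sub_unifLaw : unifLaw.map (fun x => 1 - x) = unifLaw := by
  have h := (Measure.measurePreserving_sub_left (volume : Measure ℝ) 1).restrict_preimage
    (s := Ioo (0 : ℝ) 1) measurableSet_Ioo
  have e : (fun t : ℝ => 1 - t) ⁻¹' Ioo (0 : ℝ) 1 = Ioo 0 1 := by
    ext t; simp only [mem_preimage, mem_Ioo]; constructor <;> rintro ⟨h1, h2⟩ <;>
      constructor <;> linarith
  rw [e] at h
  exact h.map_eq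

/-- Reflection preserves the uniform law and conjugates each operation into the other. -/
theorem map_one_sub_wordLaw (w : List Bool) :
    (wordLaw w).map (fun x => 1 - x) = wordLaw (w.map (! ·)) := by
  have hm : Measurable fun x : ℝ => 1 - x := by fun_prop
  induction w with
  | nil => exact map_one_sub_unifLaw
  | cons b w ih =>
    rw [List.map_cons, wordLaw, wordLaw, ← ih,
      show ((wordLaw w).map fun x => 1 - x).prod unifLaw =
        ((wordLaw w).map fun x => 1 - x).prod (unifLaw.map fun x => 1 - x) by
          rw [map_one_sub_unifLaw],
      Measure.map_prod_map _ _ hm hm, Measure.map_map hm (measurable_unitOp b),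
      Measure.map_map (measurable_unitOp _) (hm.prodMap hm)]
    congr 1
    funext p
    cases b <;> simp [unitOp] <;> ring

/-! ### The words of indices -/

/-- The word of an index. -/
def indexWord : List ℕ → List Bool
  | [] => []
  | [k] => List.replicate (k - 1) true
  | k :: l :: ls => List.replicate (k - 1) true ++ false :: indexWord (l :: ls)

/-- The interpolation of the multiple harmonic star sum `starSum k` to real arguments. -/
noncomputable def starInterp : List ℕ → ℝ → ℝ
  | [], _ => 1
  | k :: ks, s => wordSum (indexWord (k :: ks)) s

theorem wordMoment_replicate (w : List Bool) (j : ℕ) {s : ℝ} (hs : -1 < s) :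
    wordMoment (List.replicate j true ++ w) s = wordMoment w s / (s + 1) ^ j := by
  induction j with
  | zero => simp
  | succ j ih =>
    rw [List.replicate_succ, List.cons_append, wordMoment_true _ hs, ih, div_div, pow_succ]

/-- The k - 1 letters `true` contribute one factor 1/(s + 1) each. The last factor comes from the
letter `false`, which also opens the inner sum, or from the initial uniform variable in depth one.
-/
theorem wordMoment_indexWord (k : ℕ) (hk : 0 < k) (ks : List ℕ) {s : ℝ} (hs : -1 < s) :
    wordMoment (indexWord (k :: ks)) s = starInterp ks (s + 1) / (s + 1) ^ k := by
  obtain ⟨j, rfl⟩ : ∃ j, k = j + 1 := ⟨k - 1, by omega⟩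
  rcases ks with _ | ⟨l, ls⟩
  · rw [indexWord, ← List.append_nil (List.replicate _ _), wordMoment_replicate _ _ hs,
      wordMoment_nil hs, starInterp, div_div, ← pow_succ']
    rfl
  · rw [indexWord, wordMoment_replicate _ _ hs, wordMoment_false _ hs, starInterp, div_div,
      ← pow_succ']
    rfl

theorem starInterp_cons_zero (k : ℕ) (ks : List ℕ) : starInterp (k :: ks) 0 = 0 :=
  wordSum_zero _

theorem starInterp_cons_add_one (k : ℕ) (hk : 0 < k) (ks : List ℕ) {s : ℝ} (hs : -1 < s) :
    starInterp (k :: ks) (s + 1) =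
      starInterp (k :: ks) s + starInterp ks (s + 1) / (s + 1) ^ k := by
  rw [← wordMoment_indexWord k hk ks hs]
  exact wordSum_add_one _ hs

theorem starInterp_mono (ks : List ℕ) {s s' : ℝ} (hs : -1 < s) (h : s ≤ s') :
    starInterp ks s ≤ starInterp ks s' := by
  cases ks with
  | nil => exact le_rfl
  | cons k ks => exact wordSum_mono _ hs h

theorem starInterp_natCast {ks : List ℕ} (hks : IsIndex ks) (n : ℕ) :
    starInterp ks n = starSum ks n := by
  induction ks generalizing n with
  | nil => rfl
  | cons k ks ih =>
    have ih' := ih fun i hi => hks i (by simp [hi])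
    induction n with
    | zero => simp [starInterp_cons_zero, starSum]
    | succ n ihn =>
      have hn : (-1 : ℝ) < n := by linarith [n.cast_nonneg (α := ℝ)]
      rw [Nat.cast_succ, starInterp_cons_add_one k (hks k (by simp)) ks hn, ihn, starSum, starSum,
        Finset.sum_Icc_succ_top (by omega), ← Nat.cast_succ, ih', div_eq_inv_mul, one_div]

theorem wordMoment_indexWord_natCast {k : ℕ} (hk : 0 < k) {ks : List ℕ} (hks : IsIndex ks)
    (n : ℕ) :
    wordMoment (indexWord (k :: ks)) n = starSum ks (n + 1) / ((n + 1 : ℕ) : ℝ) ^ k := by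
  rw [wordMoment_indexWord k hk ks (by linarith [n.cast_nonneg (α := ℝ)]), ← Nat.cast_succ,
    starInterp_natCast hks]

theorem indexWord_one_cons {l : List ℕ} (hl : l ≠ []) :
    indexWord (1 :: l) = false :: indexWord l := by
  rcases l with _ | ⟨b, l⟩
  · exact absurd rfl hl
  · simp [indexWord]

theorem indexWord_modifyHead {l : List ℕ} (hl : l ≠ []) (hi : IsIndex l) :
    indexWord (l.modifyHead (· + 1)) = true :: indexWord l := by
  rcases l with _ | ⟨a, _ | ⟨b, l⟩⟩
  · exact absurd rfl hl
  all_goals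
    obtain ⟨c, rfl⟩ : ∃ c, a = c + 1 := ⟨a - 1, by have := hi a (by simp); omega⟩
    simp [indexWord, List.replicate_succ]

theorem indexWord_replicate_append (j : ℕ) {l : List ℕ} (hl : l ≠ []) :
    indexWord (List.replicate j 1 ++ l) = List.replicate j false ++ indexWord l := by
  induction j with
  | zero => rfl
  | succ j ih =>
    rw [List.replicate_succ, List.cons_append, indexWord_one_cons (by simp [hl]), ih,
      List.replicate_succ, List.cons_append]

theorem indexWord_replicate_one (a : ℕ) :
    indexWord (List.replicate a 1) = List.replicate (a - 1) false := by
  rcases a with _ | a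
  · rfl
  · rw [List.replicate_succ', indexWord_replicate_append _ (by simp)]
    simp [indexWord]

/-- In the word of an index of weight w, of length w - 1, the letter at position j is `false`
exactly when j is an inner partial sum. Complementing the set of partial sums therefore flips all
letters. -/
theorem indexWord_hoffmanDual {q : List ℕ} (hq : IsIndex q) :
    indexWord (hoffmanDual q) = (indexWord q).map (! ·) := by
  induction q with
  | nil => rfl
  | cons a l ih =>
    have hl : IsIndex l := fun i hi => hq i (by simp [hi])
    rcases l with _ | ⟨b, l⟩
    · rw [hoffmanDual, indexWord_replicate_one]
      simp [indexWord]
    · have hne := hoffmanDual_ne_nil hl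
      rw [hoffmanDual, indexWord_replicate_append _ (by simpa using hne),
        indexWord_modifyHead hne (hoffmanDual_spec hl).1, ih hl]
      simp [indexWord]

/-- The flipped word of `(r, q^∨)` is the word of `(1, …, 1, q₁ + 1, q₂, …)`. -/
theorem map_not_indexWord_cons_hoffmanDual (r : ℕ) {q : List ℕ} (hne : q ≠ []) (hq : IsIndex q) :
    (indexWord (r :: hoffmanDual q)).map (! ·) =
      indexWord (List.replicate (r - 1) 1 ++ q.modifyHead (· + 1)) := by
  rw [indexWord_replicate_append _ (by simpa using hne), indexWord_modifyHead hne hq]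
  rcases hd : hoffmanDual q with _ | ⟨c, d⟩
  · rcases q with _ | ⟨a, l⟩
    · exact absurd rfl hne
    · exact absurd hd (hoffmanDual_ne_nil hq)
  · rw [indexWord, ← hd, indexWord_hoffmanDual hq]
    simp [Function.comp_def]

/-! ### The generating series of the central binomial coefficients -/

theorem ascPochhammer_half_eval (n : ℕ) :
    (ascPochhammer ℝ n).eval (1 / 2) = n.factorial * (Nat.choose (2 * n) n : ℝ) / 4 ^ n := by
  induction n with
  | zero => simp
  | succ n ih =>
    have h : ((n + 1 : ℕ) : ℝ) * (Nat.choose (2 * (n + 1)) (n + 1) : ℝ) =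
        2 * (2 * n + 1) * (Nat.choose (2 * n) n : ℝ) := by
      exact_mod_cast Nat.succ_mul_centralBinom_succ n
    rw [ascPochhammer_succ_eval, ih, Nat.factorial_succ, pow_succ, Nat.cast_mul,
      mul_right_comm _ _ (Nat.choose _ _ : ℝ), h]
    field_simp
    ring

/-- The left side is the n-th binomial series coefficient of (1 - x)^(-1/2). -/
theorem choose_half_eq (n : ℕ) :
    Ring.choose ((1 / 2 : ℝ) + n - 1) n = (Nat.choose (2 * n) n : ℝ) / 4 ^ n := by
  have h := Ring.descPochhammer_eq_factorial_smul_choose ((1 / 2 : ℝ) + n - 1) n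
  rw [Polynomial.descPochhammer_smeval_eq_ascPochhammer,
    Polynomial.ascPochhammer_smeval_eq_eval,
    show (1 / 2 : ℝ) + n - 1 - n + 1 = 1 / 2 by ring, ascPochhammer_half_eval,
    nsmul_eq_mul, mul_div_assoc] at h
  exact (mul_left_cancel₀ (by positivity) h).symm

theorem hasSum_centralBinom {x : ℝ} (hx : x ∈ Ioo (0 : ℝ) 1) :
    HasSum (fun n : ℕ => (Nat.choose (2 * n) n : ℝ) / 4 ^ n * x ^ n)
      ((1 - x) ^ (-(1 / 2) : ℝ)) := by
  have h := (Real.one_div_one_sub_rpow_hasFPowerSeriesOnBall_zero (1 / 2)).hasSum (y := x)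
    (by simpa [enorm_eq_nnnorm, ← NNReal.coe_lt_coe, abs_of_pos hx.1] using hx.2)
  have e : ((1 - x) ^ (-(1 / 2) : ℝ)) = 1 / (1 - (0 + x)) ^ (1 / 2 : ℝ) := by
    rw [zero_add, Real.rpow_neg (sub_nonneg.2 hx.2.le), one_div ((1 - x) ^ _)]
  rw [e]
  convert! h using 2 with n
  rw [FormalMultilinearSeries.ofScalars_apply_eq, choose_half_eq, smul_eq_mul]

/-- The n-th moment of the word is the star-sum factor of the term with index n + 1, so the series
is the expectation of ((1 - X)^(-1/2) - 1) / X. Reflection turns this into the kernel of exponent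
-1/2 for the flipped word. -/
theorem hasSum_zetaBStarTerm {k : ℕ} (hk : 0 < k) {ks : List ℕ} (hks : IsIndex ks) :
    HasSum (fun n : ℕ => zetaBStarTerm k ks (n + 1))
      (-wordSum ((indexWord (k :: ks)).map (! ·)) (-(1 / 2))) := by
  set w := indexWord (k :: ks) with hw
  set g : ℝ → ℝ := fun x => -geomKernel (-(1 / 2)) (1 - x) with hg
  have hm : Measurable fun x : ℝ => 1 - x := by fun_prop
  have hval : -wordSum (w.map (! ·)) (-(1 / 2)) = ∫ x, g x ∂wordLaw w := by
    rw [wordSum, ← map_one_sub_wordLaw, integral_map hm.aemeasurable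
      (measurable_geomKernel _).aestronglyMeasurable, integral_neg]
  have hgi : Integrable g (wordLaw w) := by
    have h := integrable_geomKernel (w.map (! ·)) (s := -(1 / 2)) (by norm_num)
    rw [← map_one_sub_wordLaw, integrable_map_measure
      (measurable_geomKernel _).aestronglyMeasurable hm.aemeasurable] at h
    exact h.neg
  set c : ℕ → ℝ := fun n => (Nat.choose (2 * n) n : ℝ) / 4 ^ n with hc
  have hc0 : ∀ n, 0 ≤ c n := fun n => by positivity
  have hsum : ∀ x ∈ Ioo (0 : ℝ) 1, HasSum (fun n => c (n + 1) * x ^ n) (g x) := by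
    intro x hx
    have h := (hasSum_nat_add_iff' 1).2 (hasSum_centralBinom hx)
    have h2 := h.div_const x
    have hx0 := hx.1.ne'
    convert! h2 using 1
    · funext n
      rw [pow_succ x, ← mul_assoc, mul_div_cancel_right₀ _ hx0]
    · simp [g, geomKernel]
      ring
  -- The terms are nonnegative, so they serve as their own bounds, with integrable sum g.
  have key := hasSum_integral_of_dominated_convergence (μ := wordLaw w)
    (F := fun n x => c (n + 1) * x ^ n) (f := g) (fun n x => c (n + 1) * x ^ n)
    (fun n => by fun_prop)
    (fun n => by
      filter_upwards [ae_wordLaw_mem_Ioo w] with x hx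
      exact (Real.norm_of_nonneg (mul_nonneg (hc0 _) (pow_nonneg hx.1.le _))).le)
    (by filter_upwards [ae_wordLaw_mem_Ioo w] with x hx using (hsum x hx).summable)
    (hgi.congr (by filter_upwards [ae_wordLaw_mem_Ioo w] with x hx using (hsum x hx).tsum_eq.symm))
    (by filter_upwards [ae_wordLaw_mem_Ioo w] with x hx using hsum x hx)
  rw [hval]
  convert! key using 2 with n
  have hmom := wordMoment_indexWord_natCast hk hks n
  simp only [wordMoment, Real.rpow_natCast] at hmom
  rw [integral_const_mul, hmom, zetaBStarTerm]
  simp only [hc]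
  field_simp

end WordLaw

/-! ### Truncated alternating sums -/

/-- The factor `sgn(k) ^ n / n ^ |k|` of an alternating multiple zeta sum. -/
noncomputable def altLetter (k : ℤ) (n : ℕ) : ℝ := (k.sign : ℝ) ^ n / (n : ℝ) ^ k.natAbs

/-- The operator `u ↦ ∑_{n ≤ N} sgn(k) ^ n / n ^ |k| * u (n - 1)`. -/
noncomputable def altOp (k : ℤ) (u : ℕ → ℝ) (N : ℕ) : ℝ :=
  ∑ n ∈ Finset.range N, altLetter k (n + 1) * u n

theorem sum_Icc_one_eq_sum_range (f : ℕ → ℝ) (N : ℕ) :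
    ∑ n ∈ Finset.Icc 1 N, f n = ∑ n ∈ Finset.range N, f (n + 1) := by
  induction N with
  | zero => simp
  | succ N ih => rw [Finset.sum_Icc_succ_top (by omega), ih, Finset.sum_range_succ]

theorem altSum_nil : altSum [] = 1 := rfl

theorem altSum_cons (k : ℤ) (l : List ℤ) : altSum (k :: l) = altOp k (altSum l) := by
  funext N
  rw [altSum, sum_Icc_one_eq_sum_range]
  rfl

theorem altOp_zero (k : ℤ) (u : ℕ → ℝ) : altOp k u 0 = 0 := by simp [altOp]

theorem altOp_succ (k : ℤ) (u : ℕ → ℝ) (N : ℕ) :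
    altOp k u (N + 1) = altOp k u N + altLetter k (N + 1) * u N := by
  rw [altOp, Finset.sum_range_succ]; rfl

theorem altOp_add (k : ℤ) (u v : ℕ → ℝ) : altOp k (u + v) = altOp k u + altOp k v := by
  funext N; simp [altOp, mul_add, Finset.sum_add_distrib]

theorem altOp_smul {A : Subalgebra ℚ ℝ} (k : ℤ) (c : A) (u : ℕ → ℝ) :
    altOp k (c • u) = c • altOp k u := by
  funext N
  simp only [altOp, Pi.smul_apply, Finset.smul_sum, Subalgebra.smul_def, smul_eq_mul]
  exact Finset.sum_congr rfl fun n _ => by ring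

theorem altOp_zero_right (k : ℤ) : altOp k 0 = 0 := by funext N; simp [altOp]

/-- The exponent of the product of two factors. -/
def mergeExp (k l : ℤ) : ℤ := k.sign * l.sign * (k.natAbs + l.natAbs : ℕ)

theorem mergeExp_sign {k l : ℤ} (hk : k ≠ 0) : (mergeExp k l).sign = k.sign * l.sign := by
  have : ((k.natAbs + l.natAbs : ℕ) : ℤ).sign = 1 := Int.sign_eq_one_of_pos (by omega)
  rw [mergeExp, Int.sign_mul, Int.sign_mul, this, mul_one, Int.sign_sign, Int.sign_sign]

theorem mergeExp_natAbs {k l : ℤ} (hk : k ≠ 0) (hl : l ≠ 0) :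
    (mergeExp k l).natAbs = k.natAbs + l.natAbs := by
  rw [mergeExp, Int.natAbs_mul, Int.natAbs_mul, Int.natAbs_sign_of_ne_zero hk,
    Int.natAbs_sign_of_ne_zero hl, one_mul, one_mul, Int.natAbs_natCast]

theorem mergeExp_ne_zero {k l : ℤ} (hk : k ≠ 0) (hl : l ≠ 0) : mergeExp k l ≠ 0 := by
  have := mergeExp_natAbs hk hl; omega

theorem mergeExp_ne_one {k l : ℤ} (hk : k ≠ 0) (hl : l ≠ 0) : mergeExp k l ≠ 1 := by
  have := mergeExp_natAbs hk hl; omega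

theorem altLetter_mergeExp {k l : ℤ} (hk : k ≠ 0) (hl : l ≠ 0) (n : ℕ) :
    altLetter (mergeExp k l) n = altLetter k n * altLetter l n := by
  rw [altLetter, mergeExp_sign hk, mergeExp_natAbs hk hl, Int.cast_mul, mul_pow, pow_add,
    altLetter, altLetter, div_mul_div_comm]

theorem altLetter_abs_le {k : ℤ} (n : ℕ) :
    |altLetter k (n + 1)| ≤ 1 / ((n : ℝ) + 1) ^ k.natAbs := by
  have h : |((k.sign : ℤ) : ℝ)| ≤ 1 := by
    rcases lt_trichotomy k 0 with h | rfl | h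
    · simp [Int.sign_eq_neg_one_of_neg h]
    · simp
    · simp [Int.sign_eq_one_of_pos h]
  rw [altLetter, abs_div, abs_pow, abs_pow, Nat.cast_succ,
    abs_of_pos (by positivity : (0 : ℝ) < n + 1)]
  gcongr
  exact pow_le_one₀ (abs_nonneg _) h

theorem altLetter_abs_le_inv {k : ℤ} (hk : k ≠ 0) (n : ℕ) :
    |altLetter k (n + 1)| ≤ 1 / ((n : ℝ) + 1) := by
  refine (altLetter_abs_le n).trans ?_
  have : ((n : ℝ) + 1) ^ 1 ≤ ((n : ℝ) + 1) ^ k.natAbs :=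
    pow_le_pow_right₀ (by linarith [n.cast_nonneg (α := ℝ)]) (by omega)
  rw [pow_one] at this
  gcongr

/-- The discrete product rule. -/
theorem altOp_mul_altOp {k l : ℤ} (hk : k ≠ 0) (hl : l ≠ 0) (u v : ℕ → ℝ) :
    altOp k u * altOp l v =
      altOp k (u * altOp l v) + altOp l (altOp k u * v) + altOp (mergeExp k l) (u * v) := by
  funext N
  induction N with
  | zero => simp [altOp_zero]
  | succ N ih =>
    simp only [Pi.mul_apply, Pi.add_apply] at ih
    simp only [Pi.mul_apply, Pi.add_apply, altOp_succ, altLetter_mergeExp hk hl]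
    linear_combination ih

/-- The harmonic numbers, as the simplest alternating sum. -/
noncomputable def harm : ℕ → ℝ := altOp 1 1

theorem harm_mul_altOp {k : ℤ} (hk : k ≠ 0) (u : ℕ → ℝ) :
    harm * altOp k u = altOp 1 (altOp k u) + altOp k (harm * u) + altOp (mergeExp 1 k) u := by
  have := altOp_mul_altOp one_ne_zero hk 1 u
  rw [one_mul, one_mul] at this
  exact this

/-! ### Growth -/

/-- `u` grows more slowly than every positive power. -/
def IsSlow (u : ℕ → ℝ) : Prop :=
  ∀ ε : ℝ, 0 < ε → ∃ C, 0 ≤ C ∧ ∀ n : ℕ, |u n| ≤ C * ((n : ℝ) + 1) ^ ε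

/-- `u` decays at least as fast as some negative power. -/
def IsRapid (u : ℕ → ℝ) : Prop :=
  ∃ δ > 0, ∃ C, 0 ≤ C ∧ ∀ n : ℕ, |u n| ≤ C * ((n : ℝ) + 1) ^ (-δ : ℝ)

theorem one_le_natCast_add_one (n : ℕ) : (1 : ℝ) ≤ n + 1 := by
  linarith [n.cast_nonneg (α := ℝ)]

theorem IsSlow.const (c : ℝ) : IsSlow fun _ => c := fun _ hε =>
  ⟨|c|, abs_nonneg c, fun n => le_mul_of_one_le_right (abs_nonneg c)
    (Real.one_le_rpow (one_le_natCast_add_one n) hε.le)⟩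

theorem IsSlow.add {u v : ℕ → ℝ} (hu : IsSlow u) (hv : IsSlow v) : IsSlow (u + v) := by
  intro ε hε
  obtain ⟨C, hC, h⟩ := hu ε hε
  obtain ⟨D, hD, h'⟩ := hv ε hε
  refine ⟨C + D, add_nonneg hC hD, fun n => ?_⟩
  rw [add_mul]
  exact (abs_add_le _ _).trans (add_le_add (h n) (h' n))

theorem IsSlow.mul {u v : ℕ → ℝ} (hu : IsSlow u) (hv : IsSlow v) : IsSlow (u * v) := by
  intro ε hε
  obtain ⟨C, hC, h⟩ := hu (ε / 2) (by positivity)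
  obtain ⟨D, hD, h'⟩ := hv (ε / 2) (by positivity)
  refine ⟨C * D, mul_nonneg hC hD, fun n => ?_⟩
  have hn : (0 : ℝ) < n + 1 := by positivity
  rw [Pi.mul_apply, abs_mul,
    show C * D * ((n : ℝ) + 1) ^ ε = C * ((n : ℝ) + 1) ^ (ε / 2) * (D * ((n : ℝ) + 1) ^ (ε / 2)) by
      rw [← add_halves ε, Real.rpow_add hn, add_halves]; ring]
  exact mul_le_mul (h n) (h' n) (abs_nonneg _) (by positivity)

theorem harm_eq_harmonic (n : ℕ) : harm n = harmonic n := by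
  simp [harm, altOp, altLetter, harmonic]

theorem isSlow_harm : IsSlow harm := by
  intro ε hε
  refine ⟨1 + 1 / ε, by positivity, fun n => ?_⟩
  have h0 : (0 : ℝ) ≤ harmonic n := by
    rcases Nat.eq_zero_or_pos n with rfl | h
    · simp
    · exact_mod_cast (harmonic_pos h.ne').le
  rw [harm_eq_harmonic, abs_of_nonneg h0]
  have h1 := harmonic_le_one_add_log n
  have hn : (0 : ℝ) ≤ n + 1 := by positivity
  have h2 : Real.log n ≤ Real.log (n + 1) := by
    rcases Nat.eq_zero_or_pos n with rfl | h
    · simp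
    · exact Real.log_le_log (by positivity) (by linarith)
  have h3 := Real.log_le_rpow_div hn hε
  have h4 := Real.one_le_rpow (one_le_natCast_add_one n) hε.le
  rw [add_mul, one_mul, one_div_mul_eq_div]
  linarith

theorem IsSlow.altOp {k : ℤ} (hk : k ≠ 0) {u : ℕ → ℝ} (hu : IsSlow u) : IsSlow (altOp k u) := by
  intro ε hε
  obtain ⟨C, hC, h⟩ := hu (ε / 2) (by positivity)
  obtain ⟨D, hD, h'⟩ := isSlow_harm (ε / 2) (by positivity)
  refine ⟨C * D, mul_nonneg hC hD, fun N => ?_⟩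
  have hN : (0 : ℝ) < N + 1 := by positivity
  have hb : |_root_.altOp k u N| ≤ C * ((N : ℝ) + 1) ^ (ε / 2) * harm N := by
    rw [_root_.altOp, harm, _root_.altOp, Finset.mul_sum]
    refine (Finset.abs_sum_le_sum_abs _ _).trans (Finset.sum_le_sum fun n hn => ?_)
    have hnN : (n : ℝ) ≤ N := by exact_mod_cast (Finset.mem_range.1 hn).le
    rw [abs_mul, mul_comm]
    refine mul_le_mul ((h n).trans ?_) ((altLetter_abs_le_inv hk n).trans ?_) (abs_nonneg _)
      (by positivity)
    · gcongr
    · simp [altLetter]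
  refine hb.trans ?_
  rw [show C * D * ((N : ℝ) + 1) ^ ε =
    C * ((N : ℝ) + 1) ^ (ε / 2) * (D * ((N : ℝ) + 1) ^ (ε / 2)) by
      rw [← add_halves ε, Real.rpow_add hN, add_halves]; ring]
  exact mul_le_mul_of_nonneg_left ((le_abs_self _).trans (h' N)) (by positivity)

theorem isSlow_altSum {l : List ℤ} (hl : ∀ i ∈ l, i ≠ 0) : IsSlow (altSum l) := by
  induction l with
  | nil => exact IsSlow.const 1
  | cons k l ih =>
    rw [altSum_cons]
    exact IsSlow.altOp (hl k (by simp)) (ih fun i hi => hl i (by simp [hi]))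

theorem IsRapid.weaken {u : ℕ → ℝ} {C δ δ' : ℝ} (hC : 0 ≤ C) (h : δ' ≤ δ)
    (hu : ∀ n : ℕ, |u n| ≤ C * ((n : ℝ) + 1) ^ (-δ : ℝ)) (n : ℕ) :
    |u n| ≤ C * ((n : ℝ) + 1) ^ (-δ' : ℝ) :=
  (hu n).trans (mul_le_mul_of_nonneg_left
    (Real.rpow_le_rpow_of_exponent_le (one_le_natCast_add_one n) (by linarith)) hC)

theorem IsRapid.add {u v : ℕ → ℝ} (hu : IsRapid u) (hv : IsRapid v) : IsRapid (u + v) := by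
  obtain ⟨δ, hδ, C, hC, h⟩ := hu
  obtain ⟨δ', hδ', D, hD, h'⟩ := hv
  refine ⟨min δ δ', lt_min hδ hδ', C + D, add_nonneg hC hD, fun n => ?_⟩
  rw [add_mul]
  exact (abs_add_le _ _).trans (add_le_add (IsRapid.weaken hC (min_le_left _ _) h n)
    (IsRapid.weaken hD (min_le_right _ _) h' n))

theorem IsSlow.mul_isRapid {u v : ℕ → ℝ} (hu : IsSlow u) (hv : IsRapid v) : IsRapid (u * v) := by
  obtain ⟨δ, hδ, D, hD, h'⟩ := hv
  obtain ⟨C, hC, h⟩ := hu (δ / 2) (by positivity)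
  refine ⟨δ / 2, by positivity, C * D, mul_nonneg hC hD, fun n => ?_⟩
  have hn : (0 : ℝ) < n + 1 := by positivity
  rw [Pi.mul_apply, abs_mul,
    show C * D * ((n : ℝ) + 1) ^ (-(δ / 2)) =
        C * ((n : ℝ) + 1) ^ (δ / 2) * (D * ((n : ℝ) + 1) ^ (-δ)) by
      rw [show -(δ / 2) = δ / 2 + -δ by ring, Real.rpow_add hn]; ring]
  exact mul_le_mul (h n) (h' n) (abs_nonneg _) (by positivity)

theorem IsRapid.const_mul {u : ℕ → ℝ} (c : ℝ) (hu : IsRapid u) : IsRapid fun n => c * u n :=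
  (IsSlow.const c).mul_isRapid hu

theorem isRapid_zero : IsRapid 0 := ⟨1, one_pos, 0, le_rfl, fun n => by simp⟩

theorem IsRapid.tendsto {u : ℕ → ℝ} (hu : IsRapid u) : Tendsto u atTop (𝓝 0) := by
  obtain ⟨δ, hδ, C, hC, h⟩ := hu
  refine squeeze_zero_norm h ?_
  have h1 : Tendsto (fun n : ℕ => (n : ℝ) + 1) atTop atTop :=
    tendsto_natCast_atTop_atTop.atTop_add tendsto_const_nhds
  simpa using ((tendsto_rpow_neg_atTop hδ).comp h1).const_mul C

/-- The series stays summable when weighted by (n + 1)^(δ/2), and on the tail from N this weight is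
at least (N + 1)^(δ/2). So half of the exponent δ survives as a rate. -/
theorem isRapid_sum_sub_tsum {b : ℕ → ℝ} {C δ : ℝ} (hδ : 0 < δ)
    (hb : ∀ n : ℕ, |b n| ≤ C * ((n : ℝ) + 1) ^ (-(1 + δ) : ℝ)) :
    IsRapid fun N => ∑ n ∈ Finset.range N, b n - ∑' n, b n := by
  have hs : Summable fun n : ℕ => ((n : ℝ) + 1) ^ (δ / 2) * |b n| := by
    have h0 : Summable fun n : ℕ => C * ((n + 1 : ℕ) : ℝ) ^ (-(1 + δ / 2) : ℝ) :=
      ((summable_nat_add_iff 1).2 (Real.summable_nat_rpow.2 (by linarith))).mul_left C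
    refine h0.of_nonneg_of_le (fun n => by positivity) fun n => ?_
    have hn : (0 : ℝ) < n + 1 := by positivity
    rw [Nat.cast_succ, show -(1 + δ / 2) = δ / 2 + -(1 + δ) by ring, Real.rpow_add hn,
      mul_left_comm]
    exact mul_le_mul_of_nonneg_left (hb n) (by positivity)
  have hab : Summable fun n => |b n| := hs.of_nonneg_of_le (fun n => abs_nonneg _) fun n =>
    le_mul_of_one_le_left (abs_nonneg _)
      (Real.one_le_rpow (one_le_natCast_add_one n) (by positivity))
  refine ⟨δ / 2, by positivity, ∑' n : ℕ, ((n : ℝ) + 1) ^ (δ / 2) * |b n|,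
    tsum_nonneg fun n => by positivity, fun N => ?_⟩
  have hN : (0 : ℝ) < N + 1 := by positivity
  beta_reduce
  rw [← hab.of_abs.sum_add_tsum_nat_add N, sub_add_cancel_left, abs_neg, Real.rpow_neg hN.le,
    ← div_eq_mul_inv, le_div_iff₀ (by positivity), mul_comm]
  have hs' := (summable_nat_add_iff N).2 hs
  have hab' := (summable_nat_add_iff N).2 hab
  calc ((N : ℝ) + 1) ^ (δ / 2) * |∑' n, b (n + N)|
      ≤ ((N : ℝ) + 1) ^ (δ / 2) * ∑' n, |b (n + N)| := by
        gcongr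
        simpa only [Real.norm_eq_abs] using norm_tsum_le_tsum_norm (f := fun n => b (n + N)) hab'
    _ = ∑' n, ((N : ℝ) + 1) ^ (δ / 2) * |b (n + N)| := tsum_mul_left.symm
    _ ≤ ∑' n : ℕ, (((n + N : ℕ) : ℝ) + 1) ^ (δ / 2) * |b (n + N)| := by
        refine (hab'.mul_left _).tsum_le_tsum (fun n => ?_) hs'
        gcongr
        omega
    _ ≤ ∑' n : ℕ, ((n : ℝ) + 1) ^ (δ / 2) * |b n| := by
        rw [← hs.sum_add_tsum_nat_add N]
        exact le_add_of_nonneg_left (Finset.sum_nonneg fun n _ => by positivity)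

/-- Summation by parts: differences of h decay faster than h, which makes the case of leading
exponent -1 absolutely convergent. -/
theorem sum_alternating_eq (h : ℕ → ℝ) (N : ℕ) :
    ∑ n ∈ Finset.range N, (-1) ^ n * h n =
      (h 0 - (-1) ^ N * h N + ∑ n ∈ Finset.range N, (-1) ^ n * (h n - h (n + 1))) / 2 := by
  induction N with
  | zero => simp
  | succ N ih => rw [Finset.sum_range_succ, ih, Finset.sum_range_succ, pow_succ]; ring

theorem altSum_succ_sub_abs_le {l : List ℤ} (hl : ∀ i ∈ l, i ≠ 0) :
    ∃ C, 0 ≤ C ∧ ∀ n : ℕ, |altSum l (n + 1) - altSum l n| ≤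
      C * ((n : ℝ) + 1) ^ (1 / 2 : ℝ) / (n + 1) := by
  rcases l with _ | ⟨k, l⟩
  · exact ⟨0, le_rfl, fun n => by simp [altSum_nil]⟩
  · obtain ⟨C, hC, h⟩ := isSlow_altSum (l := l) (fun i hi => hl i (by simp [hi])) (1 / 2)
      (by norm_num)
    refine ⟨C, hC, fun n => ?_⟩
    rw [altSum_cons, altOp_succ, add_sub_cancel_left, abs_mul, div_eq_inv_mul, ← one_div]
    exact mul_le_mul (altLetter_abs_le_inv (hl k (by simp)) n) (h n) (abs_nonneg _)
      (by positivity)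

theorem rpow_half_div_sq {x : ℝ} (hx : 0 < x) :
    x ^ (1 / 2 : ℝ) / x ^ 2 = x ^ (-(1 + 1 / 2) : ℝ) := by
  rw [← Real.rpow_natCast, ← Real.rpow_sub hx]; norm_num

/-- Admissible sums converge at a power rate, which is needed because regularization multiplies the
error by harmonic numbers. -/
theorem exists_isRapid_altSum_sub {l : List ℤ} (hl : IsAltAdmissible l) :
    ∃ x, IsRapid fun N => altSum l N - x := by
  obtain ⟨h0, h1⟩ := hl
  rcases l with _ | ⟨k, l⟩
  · exact ⟨1, by simpa [altSum_nil] using! isRapid_zero⟩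
  have hk0 : k ≠ 0 := h0 k (by simp)
  have hk1 : k ≠ 1 := by simpa using h1
  have hl0 : ∀ i ∈ l, i ≠ 0 := fun i hi => h0 i (by simp [hi])
  obtain ⟨C, hC, h⟩ := isSlow_altSum hl0 (1 / 2) (by norm_num)
  simp only [altSum_cons]
  by_cases hk : k = -1
  · subst hk
    obtain ⟨D, hD, h'⟩ := altSum_succ_sub_abs_le hl0
    set g : ℕ → ℝ := fun n => altSum l n / (n + 1) with hg
    have hgb : ∀ n, |g n| ≤ C * ((n : ℝ) + 1) ^ (-(1 / 2) : ℝ) := by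
      intro n
      have hn : (0 : ℝ) < n + 1 := by positivity
      rw [hg, abs_div, abs_of_pos hn, div_le_iff₀ hn, mul_assoc, ← Real.rpow_add_one hn.ne']
      norm_num
      simpa using h n
    set b : ℕ → ℝ := fun n => (-1) ^ n * (g n - g (n + 1)) with hb
    have hbb : ∀ n, |b n| ≤ (C + D) * ((n : ℝ) + 1) ^ (-(1 + 1 / 2) : ℝ) := by
      intro n
      have hn : (0 : ℝ) < n + 1 := by positivity
      have hn2 : (0 : ℝ) < n + 2 := by positivity
      have e : g n - g (n + 1) = altSum l n / ((n + 1) * (n + 2)) -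
          (altSum l (n + 1) - altSum l n) / (n + 2) := by
        simp only [hg, Nat.cast_succ]
        rw [show (n : ℝ) + 1 + 1 = n + 2 by ring]
        field_simp
        ring
      simp only [hb]
      rw [abs_mul, abs_pow, abs_neg, abs_one, one_pow, one_mul, e]
      refine (abs_sub _ _).trans ?_
      rw [← rpow_half_div_sq hn, add_mul C]
      refine add_le_add ?_ ?_
      · rw [abs_div, abs_of_pos (by positivity : (0 : ℝ) < (n + 1) * (n + 2)), ← mul_div_assoc]
        refine div_le_div₀ (by positivity) (h n) (by positivity) ?_
        nlinarith
      · rw [abs_div, abs_of_pos hn2, ← mul_div_assoc, pow_two, ← div_div]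
        exact div_le_div₀ (by positivity) (h' n) hn (by linarith)
    have hR := isRapid_sum_sub_tsum (δ := 1 / 2) (by norm_num) hbb
    have hR2 : IsRapid fun N => (-1) ^ N * g N := by
      refine ⟨1 / 2, by norm_num, C, hC, fun n => ?_⟩
      rw [abs_mul, abs_pow, abs_neg, abs_one, one_pow, one_mul]
      exact hgb n
    -- The limit read off from `sum_alternating_eq`; the outer sign comes from (-1)^(n+1) in the
    -- letter of -1.
    refine ⟨-((g 0 + ∑' n, b n) / 2), ?_⟩
    convert! (hR.const_mul (-(1 / 2))).add (hR2.const_mul (1 / 2)) using 1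
    funext N
    have e : altOp (-1) (altSum l) N = -∑ n ∈ Finset.range N, (-1) ^ n * g n := by
      rw [altOp, ← Finset.sum_neg_distrib]
      refine Finset.sum_congr rfl fun n _ => ?_
      simp [altLetter, hg, pow_succ]
      ring
    rw [e, sum_alternating_eq]
    simp only [Pi.add_apply, hb]
    ring
  · have hk2 : 2 ≤ k.natAbs := by omega
    have hbb : ∀ n : ℕ, |altLetter k (n + 1) * altSum l n| ≤
        C * ((n : ℝ) + 1) ^ (-(1 + 1 / 2) : ℝ) := by
      intro n
      have hn : (0 : ℝ) < n + 1 := by positivity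
      have hp : ((n : ℝ) + 1) ^ 2 ≤ ((n : ℝ) + 1) ^ k.natAbs :=
        pow_le_pow_right₀ (one_le_natCast_add_one n) hk2
      have hL : |altLetter k (n + 1)| ≤ 1 / ((n : ℝ) + 1) ^ 2 :=
        (altLetter_abs_le n).trans (by gcongr)
      rw [abs_mul, ← rpow_half_div_sq hn, ← mul_div_assoc, div_eq_inv_mul, ← one_div]
      exact mul_le_mul hL (h n) (abs_nonneg _) (by positivity)
    exact ⟨_, isRapid_sum_sub_tsum (δ := 1 / 2) (by norm_num) hbb⟩

/-! ### Regularization -/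

/-- `u` is a polynomial in the harmonic numbers with coefficients in `A`, up to an error that
decays like a negative power. -/
def IsHarmPoly (A : Subalgebra ℚ ℝ) (u : ℕ → ℝ) : Prop :=
  ∃ P : Polynomial A, IsRapid fun N => u N - Polynomial.aeval (harm N) P

section HarmPoly
variable {A : Subalgebra ℚ ℝ}

theorem IsHarmPoly.zero : IsHarmPoly A 0 := ⟨0, by simpa using! isRapid_zero⟩

theorem IsHarmPoly.add {u v : ℕ → ℝ} (hu : IsHarmPoly A u) (hv : IsHarmPoly A v) :
    IsHarmPoly A (u + v) := by
  obtain ⟨P, hP⟩ := hu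
  obtain ⟨Q, hQ⟩ := hv
  refine ⟨P + Q, ?_⟩
  convert! hP.add hQ using 1
  funext N
  simp only [Pi.add_apply, map_add]
  ring

theorem IsHarmPoly.smul {u : ℕ → ℝ} (c : A) (hu : IsHarmPoly A u) : IsHarmPoly A (c • u) := by
  obtain ⟨P, hP⟩ := hu
  refine ⟨c • P, ?_⟩
  convert! hP.const_mul (c : ℝ) using 1
  funext N
  simp only [Pi.smul_apply, map_smul, Subalgebra.smul_def, smul_eq_mul]
  ring

theorem IsHarmPoly.harm_mul {u : ℕ → ℝ} (hu : IsHarmPoly A u) : IsHarmPoly A (harm * u) := by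
  obtain ⟨P, hP⟩ := hu
  refine ⟨Polynomial.X * P, ?_⟩
  convert! isSlow_harm.mul_isRapid hP using 1
  funext N
  simp only [Pi.mul_apply, map_mul, Polynomial.aeval_X]
  ring

theorem IsHarmPoly.span {S : Set (ℕ → ℝ)} (hS : ∀ u ∈ S, IsHarmPoly A u) {u : ℕ → ℝ}
    (hu : u ∈ Submodule.span A S) : IsHarmPoly A u := by
  induction hu using Submodule.span_induction with
  | mem u hu => exact hS u hu
  | zero => exact IsHarmPoly.zero
  | add u v _ _ hu hv => exact hu.add hv
  | smul c u _ hu => exact hu.smul c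

theorem tendsto_harm : Tendsto harm atTop atTop := by
  have h := Real.tendsto_sum_range_one_div_nat_succ_atTop
  refine h.congr fun n => ?_
  simp [harm, altOp, altLetter]

/-- Since H_N tends to infinity, a nonconstant polynomial in H_N is unbounded. Convergence leaves
only the constant coefficient. -/
theorem IsHarmPoly.limit_mem {u : ℕ → ℝ} (hu : IsHarmPoly A u) {x : ℝ}
    (hx : Tendsto u atTop (𝓝 x)) : x ∈ A := by
  obtain ⟨P, hP⟩ := hu
  have hlim : Tendsto (fun N => Polynomial.eval (harm N) (P.map (algebraMap A ℝ))) atTop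
      (𝓝 x) := by
    have := hx.sub hP.tendsto
    simpa [Polynomial.eval_map_algebraMap] using this
  by_cases hd : 0 < (P.map (algebraMap A ℝ)).degree
  · have h1 := (Polynomial.abs_tendsto_atTop _ hd).comp tendsto_harm
    exact absurd hlim.abs (not_tendsto_nhds_of_tendsto_atTop h1 _)
  · rw [Polynomial.eq_C_of_degree_le_zero (not_lt.1 hd)] at hlim
    simp only [Polynomial.eval_C] at hlim
    rw [tendsto_nhds_unique hlim tendsto_const_nhds, Polynomial.coeff_map]
    exact (P.coeff 0).2

/-- The `A`-span of the truncated alternating sums of depth at most `d`. -/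
noncomputable def altSpan (A : Subalgebra ℚ ℝ) (d : ℕ) : Submodule A (ℕ → ℝ) :=
  Submodule.span A {u | ∃ l : List ℤ, (∀ i ∈ l, i ≠ 0) ∧ l.length ≤ d ∧ altSum l = u}

/-- The `A`-span of the truncated alternating sums of depth at most `d` with at most `a` leading
exponents equal to `1`. -/
noncomputable def leadSpan (A : Subalgebra ℚ ℝ) (a d : ℕ) : Submodule A (ℕ → ℝ) :=
  Submodule.span A {u | ∃ b l, b ≤ a ∧ IsAltAdmissible l ∧ b + l.length ≤ d ∧
    altSum (List.replicate b 1 ++ l) = u}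

theorem altSum_mem_altSpan {l : List ℤ} (hl : ∀ i ∈ l, i ≠ 0) {d : ℕ} (hd : l.length ≤ d) :
    altSum l ∈ altSpan A d := Submodule.subset_span ⟨l, hl, hd, rfl⟩

theorem altSum_mem_leadSpan {b : ℕ} {l : List ℤ} (hl : IsAltAdmissible l) {a d : ℕ} (ha : b ≤ a)
    (hd : b + l.length ≤ d) : altSum (List.replicate b 1 ++ l) ∈ leadSpan A a d :=
  Submodule.subset_span ⟨b, l, ha, hl, hd, rfl⟩

theorem leadSpan_mono {a a' d d' : ℕ} (ha : a ≤ a') (hd : d ≤ d') :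
    leadSpan A a d ≤ leadSpan A a' d' :=
  Submodule.span_mono fun _ ⟨b, l, h1, h2, h3, h4⟩ => ⟨b, l, h1.trans ha, h2, h3.trans hd, h4⟩

theorem altSpan_mono {d d' : ℕ} (hd : d ≤ d') : altSpan A d ≤ altSpan A d' :=
  Submodule.span_mono fun _ ⟨l, h1, h2, h3⟩ => ⟨l, h1, h2.trans hd, h3⟩

theorem altOp_mem_of_span (k : ℤ) {S : Set (ℕ → ℝ)} {M : Submodule A (ℕ → ℝ)}
    (hS : ∀ u ∈ S, altOp k u ∈ M) {u : ℕ → ℝ} (hu : u ∈ Submodule.span A S) : altOp k u ∈ M := by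
  induction hu using Submodule.span_induction with
  | mem u hu => exact hS u hu
  | zero => rw [altOp_zero_right]; exact M.zero_mem
  | add u v _ _ hu hv => rw [altOp_add]; exact M.add_mem hu hv
  | smul c u _ hu => rw [altOp_smul]; exact M.smul_mem c hu

theorem altOp_mem_altSpan {k : ℤ} (hk : k ≠ 0) {u : ℕ → ℝ} {d : ℕ} (hu : u ∈ altSpan A d) :
    altOp k u ∈ altSpan A (d + 1) := by
  refine altOp_mem_of_span k ?_ hu
  rintro _ ⟨l, h1, h2, rfl⟩
  rw [← altSum_cons]
  exact altSum_mem_altSpan (by simpa [hk] using h1) (by simpa using h2)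

theorem altOp_mem_leadSpan_zero {k : ℤ} (hk : k ≠ 0) (hk1 : k ≠ 1) {u : ℕ → ℝ} {d : ℕ}
    (hu : u ∈ altSpan A d) : altOp k u ∈ leadSpan A 0 (d + 1) := by
  refine altOp_mem_of_span k ?_ hu
  rintro _ ⟨l, h1, h2, rfl⟩
  rw [← altSum_cons]
  exact altSum_mem_leadSpan (b := 0) (l := k :: l) ⟨by simpa [hk] using h1, by simpa using hk1⟩
    le_rfl (by simpa using h2)

theorem altOp_one_mem_leadSpan {u : ℕ → ℝ} {a d : ℕ} (hu : u ∈ leadSpan A a d) :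
    altOp 1 u ∈ leadSpan A (a + 1) (d + 1) := by
  refine altOp_mem_of_span 1 ?_ hu
  rintro _ ⟨b, l, h1, h2, h3, rfl⟩
  rw [← altSum_cons, ← List.cons_append, ← List.replicate_succ]
  exact altSum_mem_leadSpan h2 (by omega) (by omega)

theorem harm_mul_altSum_mem {l : List ℤ} (hl : ∀ i ∈ l, i ≠ 0) :
    harm * altSum l ∈ altSpan A (l.length + 1) := by
  induction l with
  | nil =>
    rw [altSum_nil, mul_one]
    have e : altSum [1] = harm := altSum_cons 1 []
    rw [← e]
    exact altSum_mem_altSpan (by simp) (by simp)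
  | cons k l ih =>
    have hk := hl k (by simp)
    have hl' : ∀ i ∈ l, i ≠ 0 := fun i hi => hl i (by simp [hi])
    rw [altSum_cons, harm_mul_altOp hk, List.length_cons]
    refine add_mem (add_mem ?_ (altOp_mem_altSpan hk (ih hl'))) ?_
    · exact altOp_mem_altSpan one_ne_zero
        (altOp_mem_altSpan hk (altSum_mem_altSpan hl' le_rfl))
    · exact altSpan_mono (by omega) (altOp_mem_altSpan (mergeExp_ne_zero one_ne_zero hk)
        (altSum_mem_altSpan hl' le_rfl))

/-- In the stuffle product with H_N, the new 1 can enter the leading block in a + 1 places, each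
giving the same sum. Inserting it further inside, or merging it with a letter, never leaves more
than a leading ones, since a merged exponent is never 1. -/
theorem harm_mul_altSum_sub_mem (a : ℕ) {l : List ℤ} (hl : IsAltAdmissible l) :
    harm * altSum (List.replicate a 1 ++ l) -
        ((a : ℝ) + 1) • altSum (List.replicate (a + 1) 1 ++ l) ∈
      leadSpan A a (a + 1 + l.length) := by
  induction a with
  | zero =>
    rcases l with _ | ⟨k, l⟩
    · have : harm * altSum (List.replicate 0 1 ++ []) -
        (((0 : ℕ) : ℝ) + 1) • altSum (List.replicate (0 + 1) 1 ++ []) = 0 := by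
        simp [altSum_nil, altSum_cons, harm]
      rw [this]
      exact zero_mem _
    · have hk : k ≠ 0 := hl.1 k (by simp)
      have hk1 : k ≠ 1 := by simpa using hl.2
      have hl' : ∀ i ∈ l, i ≠ 0 := fun i hi => hl.1 i (by simp [hi])
      have : harm * altSum (List.replicate 0 1 ++ k :: l) -
        (((0 : ℕ) : ℝ) + 1) • altSum (List.replicate (0 + 1) 1 ++ k :: l) =
          altOp k (harm * altSum l) + altOp (mergeExp 1 k) (altSum l) := by
        simp [altSum_cons, harm_mul_altOp hk, add_assoc]
      rw [this, List.length_cons, zero_add, add_comm 1]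
      refine add_mem (altOp_mem_leadSpan_zero hk hk1 (harm_mul_altSum_mem hl')) ?_
      exact leadSpan_mono le_rfl (by omega) (altOp_mem_leadSpan_zero
        (mergeExp_ne_zero one_ne_zero hk) (mergeExp_ne_one one_ne_zero hk)
        (altSum_mem_altSpan hl' le_rfl))
  | succ a ih =>
    have hw : ∀ i ∈ List.replicate a 1 ++ l, i ≠ 0 := by
      intro i hi
      rcases List.mem_append.1 hi with h | h
      · rw [List.eq_of_mem_replicate h]; exact one_ne_zero
      · exact hl.1 i h
    set u := altSum (List.replicate a 1 ++ l) with hu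
    have e1 : altSum (List.replicate (a + 1) 1 ++ l) = altOp 1 u := by
      rw [List.replicate_succ, List.cons_append, altSum_cons]
    have e2 : altSum (List.replicate (a + 1 + 1) 1 ++ l) = altOp 1 (altOp 1 u) := by
      rw [List.replicate_succ, List.cons_append, altSum_cons, e1]
    rw [e1] at ih
    have e3 : harm * altOp 1 u - (((a + 1 : ℕ) : ℝ) + 1) • altOp 1 (altOp 1 u) =
        altOp 1 (harm * u - ((a : ℝ) + 1) • altOp 1 u) + altOp (mergeExp 1 1) u := by
      rw [harm_mul_altOp one_ne_zero]
      funext N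
      simp only [Pi.add_apply, Pi.sub_apply, Pi.smul_apply, Pi.mul_apply, altOp, smul_eq_mul,
        mul_sub, Finset.sum_sub_distrib, mul_left_comm _ ((a : ℝ) + 1), ← Finset.mul_sum]
      push_cast
      ring
    rw [e1, e2, e3]
    refine add_mem (leadSpan_mono le_rfl (by omega) (altOp_one_mem_leadSpan ih)) ?_
    exact leadSpan_mono (by omega) (by simp) (altOp_mem_leadSpan_zero
      (mergeExp_ne_zero one_ne_zero one_ne_zero) (mergeExp_ne_one one_ne_zero one_ne_zero)
      (altSum_mem_altSpan (A := A) hw le_rfl))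

end HarmPoly

/-- Strong induction on the number of leading ones: without any, the sum converges to a generator of
the algebra; otherwise `harm_mul_altSum_sub_mem` is solved for its top term, dividing by a + 1. -/
theorem isHarmPoly_replicate_append {D : ℕ} (a : ℕ) {l : List ℤ} (hl : IsAltAdmissible l)
    (hD : a + l.length ≤ D) :
    IsHarmPoly (Algebra.adjoin ℚ (altMZVs D)) (altSum (List.replicate a 1 ++ l)) := by
  induction a using Nat.strong_induction_on generalizing l with
  | _ a ih =>
    rcases a with _ | a
    · obtain ⟨x, hx⟩ := exists_isRapid_altSum_sub hl
      have hlim : Tendsto (altSum l) atTop (𝓝 x) := by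
        simpa using hx.tendsto.add_const x
      have hxm : x ∈ Algebra.adjoin ℚ (altMZVs D) :=
        Algebra.subset_adjoin ⟨l, hl, by omega, hlim⟩
      exact ⟨Polynomial.C ⟨x, hxm⟩, by simpa using! hx⟩
    · have h1 := (ih a (by omega) hl (by omega)).harm_mul
      have h2 : IsHarmPoly (Algebra.adjoin ℚ (altMZVs D)) _ := IsHarmPoly.span (by
        rintro _ ⟨b, l', hb, hl', hd, rfl⟩
        exact ih b (by omega) hl' (by omega)) (harm_mul_altSum_sub_mem a hl)
      have h3 := (h1.add (h2.smul (-1))).smul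
        (algebraMap ℚ (Algebra.adjoin ℚ (altMZVs D)) (1 / ((a : ℚ) + 1)))
      convert! h3 using 1
      funext N
      have : (a : ℝ) + 1 ≠ 0 := by positivity
      simp [Rat.smul_def]
      field_simp

theorem exists_replicate_append (l : List ℤ) (hl : ∀ i ∈ l, i ≠ 0) :
    ∃ a l', IsAltAdmissible l' ∧ l = List.replicate a 1 ++ l' := by
  induction l with
  | nil => exact ⟨0, [], ⟨by simp, by simp⟩, rfl⟩
  | cons k l ih =>
    by_cases hk : k = 1
    · obtain ⟨a, l', h1, h2⟩ := ih fun i hi => hl i (by simp [hi])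
      exact ⟨a + 1, l', h1, by rw [hk, h2, List.replicate_succ, List.cons_append]⟩
    · exact ⟨0, k :: l, ⟨hl, by simpa using hk⟩, rfl⟩

theorem isHarmPoly_of_mem_altSpan {D : ℕ} {u : ℕ → ℝ}
    (hu : u ∈ altSpan (Algebra.adjoin ℚ (altMZVs D)) D) :
    IsHarmPoly (Algebra.adjoin ℚ (altMZVs D)) u := by
  refine IsHarmPoly.span ?_ hu
  rintro _ ⟨l, h1, h2, rfl⟩
  obtain ⟨a, l', h3, rfl⟩ := exists_replicate_append l h1
  exact isHarmPoly_replicate_append a h3 (by simpa using h2)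

theorem isSlow_of_mem_altSpan {A : Subalgebra ℚ ℝ} {d : ℕ} {u : ℕ → ℝ} (hu : u ∈ altSpan A d) :
    IsSlow u := by
  induction hu using Submodule.span_induction with
  | mem u hu =>
    obtain ⟨l, h1, -, rfl⟩ := hu
    exact isSlow_altSum h1
  | zero => exact IsSlow.const 0
  | add u v _ _ hu hv => exact hu.add hv
  | smul c u _ hu => exact (IsSlow.const (c : ℝ)).mul hu

/-! ### Values at half-integers -/

/-- The operator `u ↦ ∑_{n ≤ N} sgn(k) ^ n / n ^ |k| * u n`. -/
noncomputable def altStarOp (k : ℤ) (u : ℕ → ℝ) (N : ℕ) : ℝ :=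
  ∑ n ∈ Finset.range N, altLetter k (n + 1) * u (n + 1)

/-- A weak inequality between the two largest variables splits into the strict one and equality;
equality merges two letters and lowers the depth. -/
theorem altStarOp_mem_altSpan {A : Subalgebra ℚ ℝ} {k : ℤ} (hk : k ≠ 0) {u : ℕ → ℝ} {d : ℕ}
    (hu : u ∈ altSpan A d) : altStarOp k u ∈ altSpan A (d + 1) := by
  induction hu using Submodule.span_induction with
  | mem u hu =>
    obtain ⟨l, h1, h2, rfl⟩ := hu
    rcases l with _ | ⟨j, l⟩
    · exact altOp_mem_altSpan hk (altSum_mem_altSpan (l := []) (by simp) (by simp))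
    · have hj : j ≠ 0 := h1 j (by simp)
      have hl : ∀ i ∈ l, i ≠ 0 := fun i hi => h1 i (by simp [hi])
      have e : altStarOp k (altSum (j :: l)) =
          altOp k (altSum (j :: l)) + altOp (mergeExp k j) (altSum l) := by
        funext N
        simp only [altStarOp, altOp, Pi.add_apply, ← Finset.sum_add_distrib]
        refine Finset.sum_congr rfl fun n _ => ?_
        rw [altSum_cons, altOp_succ, altLetter_mergeExp hk hj]
        ring
      rw [e]
      refine add_mem (altOp_mem_altSpan hk (altSum_mem_altSpan h1 h2)) ?_
      exact altOp_mem_altSpan (mergeExp_ne_zero hk hj)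
        (altSum_mem_altSpan hl (by rw [List.length_cons] at h2; omega))
  | zero =>
    have : altStarOp k 0 = 0 := by funext N; simp [altStarOp]
    rw [this]; exact zero_mem _
  | add u v _ _ hu hv =>
    have : altStarOp k (u + v) = altStarOp k u + altStarOp k v := by
      funext N; simp [altStarOp, mul_add, Finset.sum_add_distrib]
    rw [this]; exact add_mem hu hv
  | smul c u _ hu =>
    have : altStarOp k (c • u) = c • altStarOp k u := by
      funext N
      simp only [altStarOp, Pi.smul_apply, Finset.smul_sum, Subalgebra.smul_def, smul_eq_mul]
      exact Finset.sum_congr rfl fun n _ => by ring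
    rw [this]; exact Submodule.smul_mem _ c hu

/-- The terms `(2 / n) ^ k * starInterp ks (n / 2)`, the increments of `starInterp (k :: ks)`. -/
noncomputable def starIncr (k : ℕ) (ks : List ℕ) (n : ℕ) : ℝ :=
  starInterp ks (n / 2) / ((n : ℝ) / 2) ^ k

theorem starInterp_half_succ {k : ℕ} (hk : 0 < k) (ks : List ℕ) (n : ℕ) :
    starInterp (k :: ks) ((n + 1 : ℕ) / 2) =
      starInterp (k :: ks) ((n : ℝ) / 2 - 1 / 2) + starIncr k ks (n + 1) := by
  have h := starInterp_cons_add_one k hk ks (s := (n : ℝ) / 2 - 1 / 2)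
    (by linarith [n.cast_nonneg (α := ℝ)])
  rw [show (n : ℝ) / 2 - 1 / 2 + 1 = ((n + 1 : ℕ) : ℝ) / 2 by push_cast; ring] at h
  exact h

theorem sum_starIncr {k : ℕ} (hk : 0 < k) (ks : List ℕ) (N : ℕ) :
    ∑ n ∈ Finset.range N, starIncr k ks (n + 1) =
      starInterp (k :: ks) ((N : ℝ) / 2) + starInterp (k :: ks) ((N : ℝ) / 2 - 1 / 2) -
        starInterp (k :: ks) (-(1 / 2)) := by
  induction N with
  | zero => simp [starInterp_cons_zero]
  | succ N ih =>
    rw [Finset.sum_range_succ, ih, starInterp_half_succ hk,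
      show ((N + 1 : ℕ) : ℝ) / 2 - 1 / 2 = N / 2 by push_cast; ring]
    ring

/-- The increment is a difference over two half-steps, so the alternating sum telescopes too. The
start at N = 0 leaves the value at -1/2, the value at 0 being zero. -/
theorem sum_neg_one_pow_starIncr {k : ℕ} (hk : 0 < k) (ks : List ℕ) (N : ℕ) :
    ∑ n ∈ Finset.range N, (-1) ^ (n + 1) * starIncr k ks (n + 1) =
      (-1) ^ N * (starInterp (k :: ks) ((N : ℝ) / 2) -
        starInterp (k :: ks) ((N : ℝ) / 2 - 1 / 2)) + starInterp (k :: ks) (-(1 / 2)) := by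
  induction N with
  | zero => simp [starInterp_cons_zero]
  | succ N ih =>
    rw [Finset.sum_range_succ, ih, starInterp_half_succ hk,
      show ((N + 1 : ℕ) : ℝ) / 2 - 1 / 2 = N / 2 by push_cast; ring, pow_succ]
    ring

theorem tendsto_sum_neg_one_pow_starIncr {k : ℕ} (hk : 0 < k) {ks : List ℕ}
    (hs : IsSlow fun n => starInterp ks ((n : ℝ) / 2)) :
    Tendsto (fun N => ∑ n ∈ Finset.range N, (-1) ^ (n + 1) * starIncr k ks (n + 1)) atTop
      (𝓝 (starInterp (k :: ks) (-(1 / 2)))) := by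
  simp only [sum_neg_one_pow_starIncr hk]
  have hincr : Tendsto (fun n => starIncr k ks (n + 1)) atTop (𝓝 0) := by
    obtain ⟨C, hC, h⟩ := hs (1 / 2) (by norm_num)
    -- The factor 2^k comes from (n/2)^k, and the last 2 from comparing (n + 2)^(1/2) with (n +
    -- 1)^(1/2).
    refine IsRapid.tendsto ⟨1 / 2, by norm_num, 2 ^ k * (C * 2), by positivity, fun n => ?_⟩
    have hn : (0 : ℝ) < n + 1 := by positivity
    have h1 := h (n + 1)
    have h2 : ((n : ℝ) + 1) ^ 1 ≤ ((n : ℝ) + 1) ^ k :=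
      pow_le_pow_right₀ (one_le_natCast_add_one n) hk
    have h3 : (((n + 1 : ℕ) : ℝ) + 1) ^ (1 / 2 : ℝ) ≤ 2 * ((n : ℝ) + 1) ^ (1 / 2 : ℝ) := by
      have h4 : (2 : ℝ) ^ (1 / 2 : ℝ) ≤ 2 ^ (1 : ℝ) :=
        Real.rpow_le_rpow_of_exponent_le one_le_two (by norm_num)
      rw [Real.rpow_one] at h4
      calc (((n + 1 : ℕ) : ℝ) + 1) ^ (1 / 2 : ℝ) ≤ (2 * ((n : ℝ) + 1)) ^ (1 / 2 : ℝ) := by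
            refine Real.rpow_le_rpow (by positivity) ?_ (by norm_num)
            push_cast; linarith [n.cast_nonneg (α := ℝ)]
        _ = 2 ^ (1 / 2 : ℝ) * ((n : ℝ) + 1) ^ (1 / 2 : ℝ) :=
            Real.mul_rpow (by norm_num) hn.le
        _ ≤ _ := by gcongr
    have h5 : ((n : ℝ) + 1) ^ (1 / 2 : ℝ) / (n + 1) = ((n : ℝ) + 1) ^ (-(1 / 2) : ℝ) := by
      rw [div_eq_iff hn.ne', ← Real.rpow_add_one hn.ne']; norm_num
    simp only [starIncr]
    rw [abs_div, div_pow, abs_of_pos (by positivity :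
      (0 : ℝ) < ((n + 1 : ℕ) : ℝ) ^ k / 2 ^ k), div_div_eq_mul_div, mul_comm, Nat.cast_succ,
      ← h5, mul_assoc, ← mul_div_assoc, ← mul_div_assoc]
    simp only [Nat.cast_succ] at h1 h3
    rw [pow_one] at h2
    refine div_le_div₀ (by positivity) ?_ hn h2
    refine mul_le_mul_of_nonneg_left (h1.trans ?_) (by positivity)
    rw [mul_assoc]
    exact mul_le_mul_of_nonneg_left h3 hC
  have hd : Tendsto (fun N : ℕ => (-1) ^ N * (starInterp (k :: ks) ((N : ℝ) / 2) -
      starInterp (k :: ks) ((N : ℝ) / 2 - 1 / 2))) atTop (𝓝 0) := by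
    rw [← tendsto_add_atTop_iff_nat 1]
    -- By monotonicity, a half-step difference is at most the full-step difference, which is the
    -- increment.
    refine squeeze_zero_norm (fun N => ?_) hincr
    have hN : (0 : ℝ) ≤ N := N.cast_nonneg
    have m1 := starInterp_mono (k :: ks) (s := (N : ℝ) / 2 - 1 / 2) (s' := N / 2) (by linarith)
      (by linarith)
    have m2 := starInterp_mono (k :: ks) (s := (N : ℝ) / 2) (s' := (N + 1 : ℕ) / 2)
      (by linarith) (by push_cast; linarith)
    rw [norm_mul, norm_pow, norm_neg, norm_one, one_pow, one_mul,
      show ((N + 1 : ℕ) : ℝ) / 2 - 1 / 2 = N / 2 by push_cast; ring,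
      Real.norm_of_nonneg (sub_nonneg.2 m2)]
    rw [starInterp_half_succ hk] at m2 ⊢
    linarith
  simpa using hd.add_const (starInterp (k :: ks) (-(1 / 2)))

theorem mul_mem_altSpan {A : Subalgebra ℚ ℝ} {c : ℝ} (hc : c ∈ A) {d : ℕ} {u : ℕ → ℝ}
    (hu : u ∈ altSpan A d) : (fun n => c * u n) ∈ altSpan A d :=
  Submodule.smul_mem _ (⟨c, hc⟩ : A) hu

theorem const_mem_altSpan {A : Subalgebra ℚ ℝ} {c : ℝ} (hc : c ∈ A) (d : ℕ) :
    (fun _ => c) ∈ altSpan A d := by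
  have := mul_mem_altSpan hc (altSum_mem_altSpan (l := []) (A := A) (d := d) (by simp) (by simp))
  simpa [altSum_nil] using this

/-- The interpolated star sums at half-integers are combinations of truncated alternating sums
with coefficients in the algebra of alternating multiple zeta values, and their values at `-1/2`
lie in that algebra. -/
theorem starInterp_half_spec {D : ℕ} {ks : List ℕ} (hks : IsIndex ks) (hD : ks.length ≤ D) :
    starInterp ks (-(1 / 2)) ∈ Algebra.adjoin ℚ (altMZVs D) ∧
    ∃ u ∈ altSpan (Algebra.adjoin ℚ (altMZVs D)) ks.length,
      ∃ v ∈ altSpan (Algebra.adjoin ℚ (altMZVs D)) ks.length,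
        ∀ n : ℕ, starInterp ks ((n : ℝ) / 2) = u n + (-1) ^ n * v n := by
  -- D stays fixed during the induction, so the coefficients from all depths lie in one algebra.
  set A := Algebra.adjoin ℚ (altMZVs D) with hA
  induction ks with
  | nil =>
    exact ⟨A.one_mem, 1, const_mem_altSpan A.one_mem _, 0, zero_mem _, fun n => by
      simp [starInterp]⟩
  | cons k ks ih =>
    rw [List.length_cons] at hD ⊢
    have hk : 0 < k := hks k (by simp)
    obtain ⟨-, u, hu, v, hv, huv⟩ := ih (fun i hi => hks i (by simp [hi])) (by omega)
    have hkz : (k : ℤ) ≠ 0 := by omega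
    have hkz' : -(k : ℤ) ≠ 0 := by omega
    have hslow : IsSlow fun n => starInterp ks ((n : ℝ) / 2) := by
      intro ε hε
      obtain ⟨C, hC, h⟩ := isSlow_of_mem_altSpan hu ε hε
      obtain ⟨C', hC', h'⟩ := isSlow_of_mem_altSpan hv ε hε
      refine ⟨C + C', add_nonneg hC hC', fun n => ?_⟩
      simp only [huv]
      rw [add_mul]
      refine (abs_add_le _ _).trans (add_le_add (h n) ?_)
      rw [abs_mul, abs_pow, abs_neg, abs_one, one_pow, one_mul]
      exact h' n
    have h2k : (2 : ℝ) ^ k ∈ A := by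
      have := A.algebraMap_mem ((2 : ℚ) ^ k)
      simpa using this
    have hhalf : (1 / 2 : ℝ) ∈ A := by
      have := A.algebraMap_mem (1 / 2 : ℚ)
      simpa using this
    have eterm : ∀ n, starIncr k ks (n + 1) = 2 ^ k * (altLetter k (n + 1) * u (n + 1) +
        altLetter (-k) (n + 1) * v (n + 1)) := by
      intro n
      rw [starIncr, huv]
      simp [altLetter, Int.sign_eq_one_of_pos (by omega : (0 : ℤ) < k), div_pow]
      field_simp
    have eterm' : ∀ n, (-1) ^ (n + 1) * starIncr k ks (n + 1) =
        2 ^ k * (altLetter (-k) (n + 1) * u (n + 1) + altLetter k (n + 1) * v (n + 1)) := by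
      intro n
      have hsq : ((-1 : ℝ) ^ (n + 1)) * (-1) ^ (n + 1) = 1 := by
        rw [← mul_pow]; simp
      rw [eterm]
      simp only [altLetter, Int.sign_neg, Int.natAbs_neg, Int.natAbs_natCast,
        Int.sign_eq_one_of_pos (by omega : (0 : ℤ) < k), Int.cast_neg, Int.cast_one, one_pow]
      linear_combination (2 ^ k / ((n + 1 : ℕ) : ℝ) ^ k * v (n + 1)) * hsq
    set Y : ℕ → ℝ := fun N => ∑ n ∈ Finset.range N, starIncr k ks (n + 1) with hY
    set Z : ℕ → ℝ := fun N => ∑ n ∈ Finset.range N, (-1) ^ (n + 1) * starIncr k ks (n + 1) with hZ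
    have hYm : Y ∈ altSpan A (ks.length + 1) := by
      convert! mul_mem_altSpan h2k
        (add_mem (altStarOp_mem_altSpan hkz hu) (altStarOp_mem_altSpan hkz' hv)) using 1
      funext N
      simp only [hY, eterm, ← Finset.mul_sum, Finset.sum_add_distrib, Pi.add_apply, altStarOp]
    have hZm : Z ∈ altSpan A (ks.length + 1) := by
      convert! mul_mem_altSpan h2k
        (add_mem (altStarOp_mem_altSpan hkz' hu) (altStarOp_mem_altSpan hkz hv)) using 1
      funext N
      simp only [hZ, eterm', ← Finset.mul_sum, Finset.sum_add_distrib, Pi.add_apply, altStarOp]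
    have hc : starInterp (k :: ks) (-(1 / 2)) ∈ A :=
      (isHarmPoly_of_mem_altSpan (altSpan_mono hD hZm)).limit_mem
        (tendsto_sum_neg_one_pow_starIncr hk hslow)
    -- With c = S(-1/2), Y + c and (-1)^n (Z - c) are the sum and the difference of S(n/2) and S(n/2
    -- - 1/2); half of their total is S(n/2).
    refine ⟨hc, _, mul_mem_altSpan hhalf (add_mem (const_mem_altSpan hc _) hYm),
      _, mul_mem_altSpan hhalf (sub_mem hZm (const_mem_altSpan hc _)), fun n => ?_⟩
    have hsq : ((-1 : ℝ) ^ n) * (-1) ^ n = 1 := by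
      rw [← mul_pow]; simp
    simp only [Pi.add_apply, Pi.sub_apply, hY, hZ, sum_starIncr hk, sum_neg_one_pow_starIncr hk]
    linear_combination (-(1 / 2) * (starInterp (k :: ks) ((n : ℝ) / 2) -
      starInterp (k :: ks) ((n : ℝ) / 2 - 1 / 2))) * hsq

/-! ### B-star values as interpolated star sums at -1/2 -/

theorem isIndex_shiftTail {m : List ℕ} (hm : IsIndex m) : IsIndex (shiftTail m) := by
  rcases m with _ | ⟨a, l⟩
  · exact hm
  · intro i hi
    simp only [shiftTail, List.mem_cons, List.mem_map] at hi
    rcases hi with rfl | ⟨j, -, rfl⟩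
    · exact hm _ (by simp)
    · omega

theorem length_shiftTail (m : List ℕ) : (shiftTail m).length = m.length := by
  cases m <;> simp [shiftTail]

/-- The value `ζ⋆_B(r, q^∨)` is an interpolated star sum at `-1/2`. -/
theorem exists_hasSum_zetaBStarTerm {q : List ℕ} (hq : IsIndex q) {r : ℕ} (hr : 0 < r) :
    ∃ κ : List ℕ, IsIndex κ ∧ κ.length ≤ q.length + r ∧
      HasSum (fun n : ℕ => zetaBStarTerm r (hoffmanDual q) (n + 1))
        (-starInterp κ (-(1 / 2))) := by
  have h := hasSum_zetaBStarTerm hr (hoffmanDual_spec hq).1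
  rcases q with _ | ⟨a, l⟩
  -- For empty q, the flipped word of the index (r) is r - 1 letters `false`, the word of r ones.
  · refine ⟨List.replicate r 1, fun i hi => by simp [List.eq_of_mem_replicate hi], by simp, ?_⟩
    have e : (indexWord (r :: hoffmanDual [])).map (! ·) = indexWord (List.replicate r 1) := by
      rw [indexWord_replicate_one]; simp [hoffmanDual, indexWord]
    rw [e] at h
    obtain ⟨j, rfl⟩ : ∃ j, r = j + 1 := ⟨r - 1, by omega⟩
    rw [List.replicate_succ] at h ⊢
    exact h
  · rw [map_not_indexWord_cons_hoffmanDual r (by simp) hq] at h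
    refine ⟨List.replicate (r - 1) 1 ++ (a :: l).modifyHead (· + 1), ?_, ?_, ?_⟩
    · intro i hi
      simp only [List.modifyHead_cons, List.mem_append, List.mem_replicate, List.mem_cons] at hi
      rcases hi with ⟨-, rfl⟩ | rfl | hi
      · exact one_pos
      · omega
      · exact hq i (by simp [hi])
    · simp; omega
    · obtain ⟨b, κ, e⟩ : ∃ b κ,
          List.replicate (r - 1) 1 ++ (a :: l).modifyHead (· + 1) = b :: κ :=
        List.exists_cons_of_ne_nil (by simp)
      rw [e] at h ⊢
      exact h

theorem mainTheorem6 (m : List ℕ) (hm : IsIndex m) (r : ℕ) (hr : 0 < r) :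
    Summable (fun n : ℕ => zetaBStarTerm r (hoffmanDual (shiftTail m)) (n + 1)) ∧
      zetaBStar r (hoffmanDual (shiftTail m)) ∈
        Algebra.adjoin ℚ (altMZVs (m.length + r)) := by
  obtain ⟨κ, h1, h2, h3⟩ := exists_hasSum_zetaBStarTerm (isIndex_shiftTail hm) hr
  refine ⟨h3.summable, ?_⟩
  rw [zetaBStar, h3.tsum_eq]
  rw [length_shiftTail] at h2
  exact neg_mem (starInterp_half_spec h1 h2).1
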